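/- Let $a\in\mathbb R$ and $\eta,\nu,\beta>0$, and let $h:\mathbb R\to[0,\infty)$ be measurable and bounded, nondecreasing on $[a,c)$ and nonincreasing on $(c,\infty)$ for some $a\le c\le\infty$. Consider the program of maximizing $\int_a^\infty h(x)f(x)\,dx$ over all functions $f$ that are nonnegative and convex on $[a,\infty)$ and satisfy $\int_a^\infty f(x)\,dx=\beta$, $f(a)=f(a+)=\eta$ and $f'_+(a)\ge-\nu$ (with $f'_+(a)$ finite). Its optimal value $Z^*$ is the supremum of the objective over the feasible $f$; an optimal solution is a feasible $f$ attaining it. Let $\mathcal{PL}_2^+[a,\infty)$ be the set of nonnegative continuous functions $f$ on $[a,\infty)$ for which there are $a=y_0\le y_1\le y_2<\infty$ and $c_j,d_j\in\mathbb R$ with $f(x)=c_j+d_jx$ on $[y_{j-1},y_j]$ ($j=1,2$) and $f(x)=0$ for $x>y_2$. 1. If the program is feasible, then either an optimal solution exists that lies in $\mathcal{PL}_2^+[a,\infty)$; or no optimal solution exists, and there are feasible $f^{(k)}\in\mathcal{PL}_2^+[a,\infty)$ with $\int_a^\infty h f^{(k)}\,dx\to Z^*$ whose last line segments $c_2^{(k)}+d_2^{(k)}x$,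 $x\in[y_1^{(k)},y_2^{(k)}]$ (nondegenerate: $y_1^{(k)}<y_2^{(k)}$, $d_2^{(k)}<0$) satisfy $y_2^{(k)}\nearrow\infty$ and $d_2^{(k)}\nearrow0$. Now suppose moreover that $\eta^2<2\beta\nu$, put $\mu=\eta/\nu$, $\sigma=2\beta/\nu$ and $H(x)=\int_0^x\int_0^u h(v+a)\,dv\,du$, and suppose that $\lambda=\lim_{x\to\infty}H(x)/x^2$ exists and is finite. For $x_1\in[0,\mu)$ let $$W(x_1)=\nu\left(\frac{\sigma-\mu^2}{\sigma-2\mu x_1+x_1^2}H(x_1)+\frac{(\mu-x_1)^2}{\sigma-2\mu x_1+x_1^2}H\left(\frac{\sigma-\mu x_1}{\mu-x_1}\right)\right),$$ and let $W(\mu)=\nu\left(H(\mu)+\lambda(\sigma-\mu^2)\right)$. 2. The maximum of $W$ over $[0,\mu]$ is attained, and $Z^*=\max_{x_1\in[0,\mu]}W(x_1)$. 3. If $x_1^*\in[0,\mu)$ maximizes $W$ over $[0,\mu]$, then an optimal solution is $$f^*(x)=\begin{cases}\eta-\nu(x-a),& a\le x\le x_1^*+a,\\ \eta-\nu x_1^*-\nu\frac{(\mu-x_1^*)^2}{\sigma-2\mu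 x_1^*+(x_1^*)^2}(x-a-x_1^*),& x_1^*+a\le x\le \frac{\sigma-\mu x_1^*}{\mu-x_1^*}+a,\\ 0,& x\ge\frac{\sigma-\mu x_1^*}{\mu-x_1^*}+a.\end{cases}$$ If no maximizer of $W$ over $[0,\mu]$ lies in $[0,\mu)$, then there are feasible $f^{(k)}$ with $\int_a^\infty h f^{(k)}\,dx\to Z^*$ that converge pointwise on $[a,\infty)$ to the function equal to $\eta-\nu(x-a)$ for $a\le x\le\mu+a$ and to $0$ for $x\ge\mu+a$. This second case can occur only when $\lambda>0$. -/

import Mathlib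

open MeasureTheory Set Filter Topology

namespace ConvexTail

noncomputable section

/-- Feasible tails: functions `f` (only the values on `[a, ∞)` matter) that are convex and
nonnegative on `[a, ∞)`, have total mass `β` there, satisfy `f(a) = f(a+) = η`, and have a
(finite) right derivative at `a` which is at least `-ν`. -/
structure Feasible (a η ν β : ℝ) (f : ℝ → ℝ) : Prop where
  integrable : IntegrableOn f (Ioi a)
  mass : ∫ x in Ioi a, f x = β
  value : f a = η
  right_limit : Tendsto f (𝓝[>] a) (𝓝 η)
  right_deriv : ∃ s : ℝ, HasDerivWithinAt f s (Ioi a) a ∧ -ν ≤ s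
  convex : ConvexOn ℝ (Ici a) f
  nonneg : ∀ x, a ≤ x → 0 ≤ f x

/-- The objective `∫_a^∞ h(x) f(x) dx`. -/
def objective (a : ℝ) (h f : ℝ → ℝ) : ℝ := ∫ x in Ioi a, h x * f x

/-- The set of all objective values of feasible tails. Its least upper bound is the optimal
value of the maximization program. -/
def feasibleValues (a η ν β : ℝ) (h : ℝ → ℝ) : Set ℝ :=
  {z | ∃ f, Feasible a η ν β f ∧ objective a h f = z}

/-- `f` is an optimal solution of the maximization program. -/
def IsOptimal (a η ν β : ℝ) (h f : ℝ → ℝ) : Prop :=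
  Feasible a η ν β f ∧ ∀ g, Feasible a η ν β g → objective a h g ≤ objective a h f

/-- `f` is nonnegative and continuous on `[a, ∞)`, equal to `c j + d j * x` on the `j`-th of `m`
consecutive intervals with endpoints `a = y 0 ≤ y 1 ≤ ⋯ ≤ y m`, and zero beyond `y m`. -/
structure IsPLRep (a : ℝ) (m : ℕ) (f : ℝ → ℝ) (y : Fin (m + 1) → ℝ) (c d : Fin m → ℝ) :
    Prop where
  continuousOn : ContinuousOn f (Ici a)
  nonneg : ∀ x, a ≤ x → 0 ≤ f x
  start : y 0 = a
  mono : Monotone y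
  linear : ∀ j : Fin m, ∀ x ∈ Icc (y j.castSucc) (y j.succ), f x = c j + d j * x
  vanish : ∀ x, y (Fin.last m) < x → f x = 0

/-- Nonnegative continuous piecewise linear functions on `[a, ∞)` with at most `m` line segments
before vanishing. -/
def PLPlus (a : ℝ) (m : ℕ) : Set (ℝ → ℝ) := {f | ∃ y c d, IsPLRep a m f y c d}

/-- `h` is nonnegative and bounded, nondecreasing on `[a, c)` and nonincreasing on `(c, ∞)`,
for some `a ≤ c ≤ ∞`. -/
structure IsRegular (a : ℝ) (h : ℝ → ℝ) : Prop where
  nonneg : ∀ x, 0 ≤ h x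
  bounded : ∃ C : ℝ, ∀ x, h x ≤ C
  unimodal : ∃ c : EReal, (a : EReal) ≤ c ∧
    MonotoneOn h {x : ℝ | a ≤ x ∧ (x : EReal) < c} ∧ AntitoneOn h {x : ℝ | c < (x : EReal)}

/-- `H(x) = ∫_0^x ∫_0^u h(v + a) dv du`. -/
def H (a : ℝ) (h : ℝ → ℝ) (x : ℝ) : ℝ := ∫ u in (0 : ℝ)..x, ∫ v in (0 : ℝ)..u, h (v + a)

/-- `μ = η / ν`. -/
def mean (η ν : ℝ) : ℝ := η / ν

/-- `σ = 2β / ν`. -/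
def second (ν β : ℝ) : ℝ := 2 * β / ν

/-- `(σ - μ x₁) / (μ - x₁)`; used only for `x₁ < μ`. -/
def farPoint (η ν β x₁ : ℝ) : ℝ := (second ν β - mean η ν * x₁) / (mean η ν - x₁)

/-- `(σ - μ²) / (σ - 2μ x₁ + x₁²)`. -/
def nearWeight (η ν β x₁ : ℝ) : ℝ :=
  (second ν β - mean η ν ^ 2) / (second ν β - 2 * mean η ν * x₁ + x₁ ^ 2)

/-- `(μ - x₁)² / (σ - 2μ x₁ + x₁²)`. -/
def farWeight (η ν β x₁ : ℝ) : ℝ :=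
  (mean η ν - x₁) ^ 2 / (second ν β - 2 * mean η ν * x₁ + x₁ ^ 2)

/-- The line-search function `W` on `[0, μ]`, with its separate definition at `μ`. -/
def W (a η ν β : ℝ) (h : ℝ → ℝ) (lam x₁ : ℝ) : ℝ :=
  if x₁ = mean η ν then
    ν * (H a h (mean η ν) + lam * (second ν β - mean η ν ^ 2))
  else
    ν * (nearWeight η ν β x₁ * H a h x₁ + farWeight η ν β x₁ * H a h (farPoint η ν β x₁))

/-- The two-piece density with kink at `x₁ + a`. -/
def twoPiece (a η ν β x₁ x : ℝ) : ℝ :=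
  if x ≤ x₁ + a then η - ν * (x - a)
  else if x ≤ farPoint η ν β x₁ + a then
    η - ν * x₁ - ν * farWeight η ν β x₁ * (x - a - x₁)
  else 0

/-- The line `η - ν (x - a)` cut at `μ + a`. -/
def cutLine (a η ν x : ℝ) : ℝ := if x ≤ mean η ν + a then η - ν * (x - a) else 0

end

end ConvexTail

open ConvexTail

/-! The hinge `x ↦ (a + u - x)⁺` has value `u` at `a`, mass `u² / 2` and objective `H(u)`. A
probability measure on kinks `u ≥ 0` with mean `μ` and second moment `σ`, scaled by `ν`, therefore
mixes hinges into a feasible tail. Two-point measures give the two-piece tails, and `W` is their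
objective. No general feasible `f` is decomposed into hinges; each is compared directly with one
two-piece tail.

Suppose the mode `c` of `h` is finite. `Feasible.exists_twoPiece` finds a two-piece tail `T` with
the mass of `f` beyond `c`, with `f c ≤ T c` and with `c` on its second piece. By convexity of `f`,
the difference `T - f` changes sign at most once on each side of `c`: upwards before `c`, downwards
after it. It has mean zero on each side, so the monotonicity of `h` gives `∫ h (T - f) ≥ 0` on both
(`objective_le_twoPiece`).

If `h` is nondecreasing with limit `L`, compare the deficits `∫ (L - h) f` instead. Every feasible
`f` lies above its steepest admissible line. If `h` reaches `L` before `a + μ`, a kink placed there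
makes the deficit minimal. Otherwise the deficit of `f` strictly exceeds that of the cut line, and
the objective stays strictly below `W(μ)`. This strictness is what rules out an optimum when no kink
in `[0, μ)` maximizes `W`.

As the kink tends to `μ`, the far point escapes to infinity while its share of the second moment
tends to `σ - μ²`. Hence `W` is continuous on `[0, μ]` and attains its maximum, and kinks tending to
`μ` give optimizing sequences when only `μ` maximizes. -/

namespace ConvexTail

/-! ### Hinge functions and their objective -/

section

/-- The hinge function `x ↦ (u - x)⁺`. -/
def hinge (u x : ℝ) : ℝ := max (u - x) 0

lemma hinge_nonneg (u x : ℝ) : 0 ≤ hinge u x := le_max_right _ _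

lemma hinge_of_le {u x : ℝ} (hx : x ≤ u) : hinge u x = u - x :=
  max_eq_left (sub_nonneg.2 hx)

lemma hinge_of_ge {u x : ℝ} (hx : u ≤ x) : hinge u x = 0 :=
  max_eq_right (sub_nonpos.2 hx)

lemma continuous_hinge (u : ℝ) : Continuous (hinge u) := by
  unfold hinge; fun_prop

lemma convexOn_hinge (u : ℝ) : ConvexOn ℝ univ (hinge u) :=
  ((convexOn_const u convex_univ).sub (concaveOn_id convex_univ)).sup
    (convexOn_const 0 convex_univ)

lemma hinge_eq_zero_of_mem_diff {u c x : ℝ} (hx : x ∈ Ioi c \ Ioc c u) : hinge u x = 0 :=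
  hinge_of_ge (not_le.1 fun hle => hx.2 ⟨hx.1, hle⟩).le

lemma integrableOn_hinge (u c : ℝ) : IntegrableOn (hinge u) (Ioi c) := by
  have h1 : IntegrableOn (hinge u) (Ioc c u) :=
    ((continuous_hinge u).integrableOn_Icc (a := c) (b := u)).mono_set Ioc_subset_Icc_self
  exact h1.of_forall_sdiff_eq_zero measurableSet_Ioi fun x hx => hinge_eq_zero_of_mem_diff hx

lemma integral_hinge (u c : ℝ) : ∫ x in Ioi c, hinge u x = hinge u c ^ 2 / 2 := by
  rw [setIntegral_eq_of_subset_of_forall_sdiff_eq_zero measurableSet_Ioi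
    (show Ioc c u ⊆ Ioi c from Ioc_subset_Ioi_self) fun x hx => hinge_eq_zero_of_mem_diff hx]
  rcases le_total c u with hcu | huc
  · rw [← intervalIntegral.integral_of_le hcu]
    have h1 : ∫ x in c..u, hinge u x = ∫ x in c..u, (u - x) :=
      intervalIntegral.integral_congr fun x hx => by
        rw [uIcc_of_le hcu] at hx
        exact hinge_of_le hx.2
    rw [h1, hinge_of_le hcu, intervalIntegral.integral_sub (by simp) (by simp)]
    simp
    ring
  · rw [Ioc_eq_empty (not_lt.2 huc), hinge_of_ge huc]
    simp

/-- Cauchy's formula for repeated integration: Fubini on the triangle `0 < v ≤ s ≤ u`. -/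
lemma integral_primitive_eq {k : ℝ → ℝ} (hk : Measurable k) {C : ℝ} (hC : ∀ x, |k x| ≤ C)
    {u : ℝ} (hu : 0 ≤ u) :
    ∫ s in (0 : ℝ)..u, ∫ v in (0 : ℝ)..s, k v = ∫ v in (0 : ℝ)..u, k v * (u - v) := by
  have key : ∀ s ∈ Ioc 0 u, ∫ v in (0 : ℝ)..s, k v
      = ∫ v in Ioc 0 u, (Ioc 0 s).indicator k v := by
    intro s hs
    rw [intervalIntegral.integral_of_le hs.1.le, setIntegral_indicator measurableSet_Ioc,
      inter_eq_right.2 (Ioc_subset_Ioc_right hs.2)]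
  rw [intervalIntegral.integral_of_le hu, intervalIntegral.integral_of_le hu,
    setIntegral_congr_fun measurableSet_Ioc key, integral_integral_swap]
  · refine setIntegral_congr_fun measurableSet_Ioc fun v hv => ?_
    have h1 : ∀ s, (Ioc 0 s).indicator k v = (Ici v).indicator (fun _ => k v) s := by
      intro s
      simp only [indicator, mem_Ioc, mem_Ici]
      simp [hv.1]
    simp only [h1]
    rw [setIntegral_indicator measurableSet_Ici]
    have h2 : Ioc 0 u ∩ Ici v = Icc v u := by
      ext s
      simp only [mem_inter_iff, mem_Ioc, mem_Ici, mem_Icc]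
      exact ⟨fun h => ⟨h.2, h.1.2⟩, fun h => ⟨⟨hv.1.trans_le h.1, h.2⟩, h.1⟩⟩
    rw [h2, setIntegral_const]
    simp [Real.volume_real_Icc_of_le hv.2, mul_comm]
  · have hm : Measurable fun p : ℝ × ℝ => (Ioc 0 p.1).indicator k p.2 := by
      have : (fun p : ℝ × ℝ => (Ioc 0 p.1).indicator k p.2)
          = {p : ℝ × ℝ | 0 < p.2 ∧ p.2 ≤ p.1}.indicator (fun p => k p.2) := by
        ext p
        simp [indicator]
      rw [this]
      refine (hk.comp measurable_snd).indicator ?_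
      exact (measurableSet_lt measurable_const measurable_snd).inter
        (measurableSet_le measurable_snd measurable_fst)
    refine Integrable.of_bound hm.aestronglyMeasurable C (ae_of_all _ fun p => ?_)
    exact (norm_indicator_le_norm_self _ _).trans (hC _)

lemma objective_hinge {a : ℝ} {h : ℝ → ℝ} (hmeas : Measurable h) {C : ℝ} (hC : ∀ x, |h x| ≤ C)
    {u : ℝ} (hu : 0 ≤ u) : objective a h (hinge (a + u)) = H a h u := by
  unfold objective H
  rw [integral_primitive_eq (k := fun v => h (v + a)) (hmeas.comp (measurable_id.add_const a))
      (fun x => hC (x + a)) hu,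
    setIntegral_eq_of_subset_of_forall_sdiff_eq_zero measurableSet_Ioi
      (show Ioc a (a + u) ⊆ Ioi a from Ioc_subset_Ioi_self) fun x hx => by
        rw [hinge_eq_zero_of_mem_diff hx, mul_zero],
    ← intervalIntegral.integral_of_le (by linarith)]
  have h1 := intervalIntegral.integral_comp_add_right (a := 0) (b := u)
    (fun x => h x * hinge (a + u) x) a
  rw [zero_add, add_comm u a] at h1
  rw [← h1]
  refine intervalIntegral.integral_congr fun v hv => ?_
  rw [uIcc_of_le hu] at hv
  rw [hinge_of_le (by linarith [hv.2])]
  ring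

lemma integrableOn_mul_of_bounded {h f : ℝ → ℝ} (hmeas : Measurable h) {C : ℝ}
    (hC : ∀ x, |h x| ≤ C) {s : Set ℝ} (hf : IntegrableOn f s) :
    IntegrableOn (fun x => h x * f x) s :=
  Integrable.bdd_mul hf hmeas.aestronglyMeasurable (ae_of_all _ hC)

end

/-! ### Crossing inequality and lower bounds for feasible tails -/

section

/-- If a function `g` of zero mean is negative only where `h` is no larger than where `g` is
positive, then `h` and `g` are nonnegatively correlated. -/
lemma setIntegral_mul_nonneg_of_crossing {h g : ℝ → ℝ} {s : Set ℝ} (hs : MeasurableSet s)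
    (hmeas : Measurable h) {C : ℝ} (h0 : ∀ x, 0 ≤ h x) (hC : ∀ x, h x ≤ C)
    (hg : IntegrableOn g s) (hint : ∫ x in s, g x = 0)
    (hcross : ∀ x ∈ s, ∀ y ∈ s, g x < 0 → 0 < g y → h x ≤ h y) :
    0 ≤ ∫ x in s, h x * g x := by
  -- The level `sSup T` separates the values of `h` where `g < 0` from those where `g > 0`, and
  -- subtracting it from `h` costs nothing as `g` has mean zero. If `T` is empty the default `sSup ∅
  -- = 0` still works, since `h ≥ 0`.
  set T : Set ℝ := h '' {x ∈ s | g x < 0} with hT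
  have hbdd : BddAbove T := ⟨C, by rintro _ ⟨x, _, rfl⟩; exact hC x⟩
  have hk : ∀ x ∈ s, 0 ≤ (h x - sSup T) * g x := by
    intro x hx
    rcases lt_trichotomy (g x) 0 with hneg | hzero | hpos
    · exact mul_nonneg_of_nonpos_of_nonpos
        (sub_nonpos.2 (le_csSup hbdd ⟨x, ⟨hx, hneg⟩, rfl⟩)) hneg.le
    · simp [hzero]
    · refine mul_nonneg (sub_nonneg.2 (Real.sSup_le ?_ (h0 x))) hpos.le
      rintro _ ⟨z, ⟨hz, hzneg⟩, rfl⟩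
      exact hcross z hz x hx hzneg hpos
  have h1 := setIntegral_nonneg (μ := volume) hs hk
  have hi := integrableOn_mul_of_bounded hmeas
    (fun x => by rw [abs_of_nonneg (h0 x)]; exact hC x) hg
  simp only [sub_mul] at h1
  rw [integral_sub hi (hg.const_mul _), integral_const_mul, hint] at h1
  linarith

variable {a η ν β : ℝ} {f : ℝ → ℝ}

lemma Feasible.tangent_le (hf : Feasible a η ν β f) {x : ℝ} (hx : a ≤ x) :
    η - ν * (x - a) ≤ f x := by
  rcases hx.eq_or_lt with rfl | hx
  · simp [hf.value]
  obtain ⟨s, hs, hνs⟩ := hf.right_deriv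
  have h1 := hf.convex.le_slope_of_hasDerivWithinAt_Ioi (x := a) (y := x) self_mem_Ici (mem_Ici.2 hx.le) hx hs
  rw [slope_def_field, le_div_iff₀ (sub_pos.2 hx), hf.value] at h1
  nlinarith

lemma Feasible.continuousOn (hf : Feasible a η ν β f) : ContinuousOn f (Ioi a) := by
  have h1 := hf.convex.continuousOn_interior
  rwa [interior_Ici] at h1

lemma Feasible.hinge_le (hν : 0 < ν) (hf : Feasible a η ν β f) {x : ℝ} (hx : a ≤ x) :
    ν * hinge (a + mean η ν) x ≤ f x := by
  rcases le_total x (a + mean η ν) with hle | hge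
  · rw [hinge_of_le hle]
    have := hf.tangent_le hx
    have h2 : ν * mean η ν = η := by unfold mean; field_simp
    nlinarith
  · rw [hinge_of_ge hge, mul_zero]
    exact hf.nonneg x hx

/-- A nonnegative convex integrable function that vanishes at a point vanishes beyond it. -/
lemma Feasible.eq_zero_of_le (hf : Feasible a η ν β f) {x y : ℝ} (hx : a ≤ x) (hxy : x ≤ y)
    (h0 : f x = 0) : f y = 0 := by
  by_contra hne
  have hypos : 0 < f y := lt_of_le_of_ne (hf.nonneg y (hx.trans hxy)) (Ne.symm hne)
  have hxy' : x < y := lt_of_le_of_ne hxy fun h => hne (h ▸ h0)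
  -- A positive slope from `x` to `y` persists by convexity, so `f` stays above `f y > 0` on a
  -- half-line and cannot be integrable.
  have hge : ∀ z ∈ Ioi y, f y ≤ f z := by
    intro z hz
    have h1 := hf.convex.slope_mono_adjacent (x := x) (y := y) (z := z) hx
      (hx.trans (hxy.trans (le_of_lt hz))) hxy' hz
    rw [h0, sub_zero] at h1
    have h2 : 0 < f y / (y - x) := div_pos hypos (sub_pos.2 hxy')
    have h3 := h2.trans_le h1
    have h4 := (div_pos_iff_of_pos_right (sub_pos.2 hz)).1 h3
    linarith
  have hint : IntegrableOn f (Ioi y) := hf.integrable.mono_set (Ioi_subset_Ioi (hx.trans hxy))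
  have hconst : IntegrableOn (fun _ : ℝ => f y) (Ioi y) := by
    refine Integrable.mono' hint aestronglyMeasurable_const ?_
    refine (ae_restrict_iff' measurableSet_Ioi).2 (ae_of_all _ fun z hz => ?_)
    rw [Real.norm_of_nonneg hypos.le]
    exact hge z hz
  rw [integrableOn_const_iff] at hconst
  simp [hne] at hconst

end

/-! ### Two-piece tails and the cut line as mixtures of hinges -/

section

variable {a η ν β x₁ : ℝ}

lemma mul_mean (hν : 0 < ν) : ν * mean η ν = η := by
  unfold mean; field_simp

lemma mul_second (hν : 0 < ν) : ν * second ν β = 2 * β := by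
  unfold second; field_simp

lemma mean_pos (hη : 0 < η) (hν : 0 < ν) : 0 < mean η ν := div_pos hη hν

lemma mean_sq_lt_second (hν : 0 < ν) (hlt : η ^ 2 < 2 * β * ν) :
    mean η ν ^ 2 < second ν β := by
  unfold mean second
  rw [div_pow, div_lt_div_iff₀ (by positivity) hν]
  nlinarith

lemma denom_pos (hσ : mean η ν ^ 2 < second ν β) (x₁ : ℝ) :
    0 < second ν β - 2 * mean η ν * x₁ + x₁ ^ 2 := by
  nlinarith [sq_nonneg (mean η ν - x₁)]

lemma farPoint_eq (hx : x₁ < mean η ν) :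
    farPoint η ν β x₁ * (mean η ν - x₁) = second ν β - mean η ν * x₁ := by
  unfold farPoint
  rw [div_mul_cancel₀ _ (sub_pos.2 hx).ne']

lemma mean_lt_farPoint (hσ : mean η ν ^ 2 < second ν β) (hx : x₁ < mean η ν) :
    mean η ν < farPoint η ν β x₁ := by
  unfold farPoint
  rw [lt_div_iff₀ (sub_pos.2 hx)]
  nlinarith

lemma nearWeight_add_farWeight (hσ : mean η ν ^ 2 < second ν β) :
    nearWeight η ν β x₁ + farWeight η ν β x₁ = 1 := by
  unfold nearWeight farWeight
  rw [← add_div, div_eq_iff (denom_pos hσ x₁).ne']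
  ring

/-- With the total mass and second moment, this says that the weights at `x₁` and the far point form
the two-point law with mean `μ` and second moment `σ`. These identities encode the value at `a` and
the mass of the two-piece tail. -/
lemma weights_first_moment (hσ : mean η ν ^ 2 < second ν β) (hx : x₁ < mean η ν) :
    nearWeight η ν β x₁ * x₁ + farWeight η ν β x₁ * farPoint η ν β x₁ = mean η ν := by
  unfold nearWeight farWeight
  rw [div_mul_eq_mul_div, div_mul_eq_mul_div, ← add_div, div_eq_iff (denom_pos hσ x₁).ne']
  linear_combination (mean η ν - x₁) * farPoint_eq (β := β) hx

lemma weights_second_moment (hσ : mean η ν ^ 2 < second ν β) (hx : x₁ < mean η ν) :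
    nearWeight η ν β x₁ * x₁ ^ 2 + farWeight η ν β x₁ * farPoint η ν β x₁ ^ 2
      = second ν β := by
  unfold nearWeight farWeight
  rw [div_mul_eq_mul_div, div_mul_eq_mul_div, ← add_div, div_eq_iff (denom_pos hσ x₁).ne']
  linear_combination (farPoint η ν β x₁ * (mean η ν - x₁) + (second ν β - mean η ν * x₁)) * farPoint_eq (β := β) hx

lemma nearWeight_pos (hσ : mean η ν ^ 2 < second ν β) : 0 < nearWeight η ν β x₁ :=
  div_pos (sub_pos.2 hσ) (denom_pos hσ x₁)

lemma farWeight_pos (hσ : mean η ν ^ 2 < second ν β) (hx : x₁ < mean η ν) :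
    0 < farWeight η ν β x₁ :=
  div_pos (pow_pos (sub_pos.2 hx) 2) (denom_pos hσ x₁)

lemma twoPiece_eq_hinge (hν : 0 < ν) (hσ : mean η ν ^ 2 < second ν β)
    (hx : x₁ < mean η ν) (x : ℝ) :
    twoPiece a η ν β x₁ x = ν * nearWeight η ν β x₁ * hinge (a + x₁) x
      + ν * farWeight η ν β x₁ * hinge (a + farPoint η ν β x₁) x := by
  have h2 := mean_lt_farPoint hσ hx
  have hm1 := nearWeight_add_farWeight (x₁ := x₁) hσ
  have hm2 := weights_first_moment hσ hx
  have hm := mul_mean (η := η) hν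
  have hn : nearWeight η ν β x₁ = 1 - farWeight η ν β x₁ := by linarith
  rw [hn] at hm2 ⊢
  unfold twoPiece
  split_ifs with h3 h4
  · rw [hinge_of_le (by linarith), hinge_of_le (by linarith)]
    linear_combination (-ν) * hm2 - hm
  · rw [hinge_of_ge (by linarith), hinge_of_le (by linarith)]
    linear_combination (-ν) * hm2 - hm
  · rw [hinge_of_ge (by linarith), hinge_of_ge (by linarith)]
    ring

lemma cutLine_eq_hinge (hν : 0 < ν) (x : ℝ) :
    cutLine a η ν x = ν * hinge (a + mean η ν) x := by
  have hm := mul_mean (η := η) hν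
  unfold cutLine
  split_ifs with h1
  · rw [hinge_of_le (by linarith)]
    linear_combination -hm
  · rw [hinge_of_ge (by linarith), mul_zero]

lemma hasDerivWithinAt_hinge_of_lt {u x : ℝ} (hx : x < u) (s : Set ℝ) :
    HasDerivWithinAt (hinge u) (-1) s x := by
  have h1 : HasDerivAt (fun y => u - y) (-1) x := by
    simpa using (hasDerivAt_id x).const_sub u
  refine (h1.congr_of_eventuallyEq ?_).hasDerivWithinAt
  filter_upwards [Iio_mem_nhds hx] with y hy
  exact hinge_of_le (le_of_lt hy)

lemma hasDerivWithinAt_hinge_self (u : ℝ) : HasDerivWithinAt (hinge u) 0 (Ioi u) u :=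
  (hasDerivWithinAt_const u (Ioi u) (0 : ℝ)).congr (fun _ hy => hinge_of_ge (le_of_lt hy))
    (hinge_of_ge le_rfl)

/-- Mixtures of two hinges with prescribed moments are feasible. -/
lemma feasible_hinge_mix {p q u v : ℝ} (hp : 0 ≤ p) (hq : 0 ≤ q) (hpq : p + q ≤ ν)
    (hu : 0 ≤ u) (hv : 0 ≤ v) (h1 : p * u + q * v = η) (h2 : p * u ^ 2 + q * v ^ 2 = 2 * β) :
    Feasible a η ν β (fun x => p * hinge (a + u) x + q * hinge (a + v) x) where
  integrable := ((integrableOn_hinge _ _).const_mul p).add ((integrableOn_hinge _ _).const_mul q)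
  mass := by
    rw [integral_add ((integrableOn_hinge _ _).const_mul p)
      ((integrableOn_hinge _ _).const_mul q), integral_const_mul, integral_const_mul,
      integral_hinge, integral_hinge, hinge_of_le (by linarith), hinge_of_le (by linarith)]
    linear_combination h2 / 2
  value := by
    rw [hinge_of_le (by linarith), hinge_of_le (by linarith)]
    linear_combination h1
  right_limit := by
    have hc : Continuous (fun x => p * hinge (a + u) x + q * hinge (a + v) x) :=
      ((continuous_hinge _).const_mul p).add ((continuous_hinge _).const_mul q)
    have h3 := (hc.tendsto a).mono_left (nhdsWithin_le_nhds (s := Ioi a))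
    rw [hinge_of_le (by linarith), hinge_of_le (by linarith)] at h3
    convert h3 using 2
    linear_combination -h1
  right_deriv := by
    have hd : ∀ w : ℝ, 0 ≤ w →
        ∃ s : ℝ, HasDerivWithinAt (hinge (a + w)) s (Ioi a) a ∧ -1 ≤ s := by
      intro w hw
      rcases hw.eq_or_lt with rfl | hw
      · exact ⟨0, by simpa using hasDerivWithinAt_hinge_self a, by norm_num⟩
      · exact ⟨-1, hasDerivWithinAt_hinge_of_lt (by linarith) _, le_rfl⟩
    obtain ⟨s, hs, hs1⟩ := hd u hu
    obtain ⟨t, ht, ht1⟩ := hd v hv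
    exact ⟨p * s + q * t, (hs.const_mul p).add (ht.const_mul q), by nlinarith⟩
  convex := by
    have h3 := ((convexOn_hinge (a + u)).smul hp).add ((convexOn_hinge (a + v)).smul hq)
    exact h3.subset (subset_univ _) (convex_Ici a)
  nonneg x _ := add_nonneg (mul_nonneg hp (hinge_nonneg _ _)) (mul_nonneg hq (hinge_nonneg _ _))

lemma feasible_twoPiece (hη : 0 < η) (hν : 0 < ν) (hσ : mean η ν ^ 2 < second ν β)
    (hx0 : 0 ≤ x₁) (hx : x₁ < mean η ν) : Feasible a η ν β (twoPiece a η ν β x₁) := by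
  have h2 := mean_lt_farPoint hσ hx
  have hμ := mean_pos hη hν
  rw [funext (twoPiece_eq_hinge (a := a) hν hσ hx)]
  refine feasible_hinge_mix (mul_pos hν (nearWeight_pos hσ)).le
    (mul_pos hν (farWeight_pos hσ hx)).le ?_ hx0 (by linarith) ?_ ?_
  · rw [← mul_add, nearWeight_add_farWeight hσ, mul_one]
  · rw [mul_assoc, mul_assoc, ← mul_add, weights_first_moment hσ hx, mul_mean hν]
  · rw [mul_assoc, mul_assoc, ← mul_add, weights_second_moment hσ hx, mul_second hν]

lemma feasible_cutLine (hη : 0 < η) (hν : 0 < ν) (hσ : mean η ν ^ 2 = second ν β) :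
    Feasible a η ν β (cutLine a η ν) := by
  have hμ := mean_pos hη hν
  have h1 := feasible_hinge_mix (a := a) (η := η) (ν := ν) (β := β) (p := ν) (q := 0)
    (u := mean η ν) (v := 0) hν.le le_rfl (by simp) hμ.le le_rfl (by simp [mul_mean hν])
    (by rw [hσ, mul_second hν]; ring)
  convert h1 using 2 with x
  rw [cutLine_eq_hinge hν]
  ring

lemma objective_hinge_mix {h : ℝ → ℝ} (hmeas : Measurable h) {C : ℝ} (hC : ∀ x, |h x| ≤ C)
    {u v : ℝ} (hu : 0 ≤ u) (hv : 0 ≤ v) (p q : ℝ) :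
    objective a h (fun x => p * hinge (a + u) x + q * hinge (a + v) x)
      = p * H a h u + q * H a h v := by
  rw [← objective_hinge hmeas hC hu, ← objective_hinge hmeas hC hv]
  unfold objective
  rw [← integral_const_mul, ← integral_const_mul, ← integral_add]
  · congr 1
    ext x
    ring
  · exact (integrableOn_mul_of_bounded hmeas hC (integrableOn_hinge _ _)).const_mul p
  · exact (integrableOn_mul_of_bounded hmeas hC (integrableOn_hinge _ _)).const_mul q

lemma objective_twoPiece {h : ℝ → ℝ} (hmeas : Measurable h) {C : ℝ} (hC : ∀ x, |h x| ≤ C)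
    (hη : 0 < η) (hν : 0 < ν) (hσ : mean η ν ^ 2 < second ν β)
    (hx0 : 0 ≤ x₁) (hx : x₁ < mean η ν) (lam : ℝ) :
    objective a h (twoPiece a η ν β x₁) = W a η ν β h lam x₁ := by
  have h2 := mean_lt_farPoint hσ hx
  have hμ := mean_pos hη hν
  rw [funext (twoPiece_eq_hinge (a := a) hν hσ hx),
    objective_hinge_mix hmeas hC hx0 (by linarith), W, if_neg hx.ne]
  ring

lemma objective_cutLine {h : ℝ → ℝ} (hmeas : Measurable h) {C : ℝ} (hC : ∀ x, |h x| ≤ C)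
    (hη : 0 < η) (hν : 0 < ν) :
    objective a h (cutLine a η ν) = ν * H a h (mean η ν) := by
  have h1 := objective_hinge_mix (a := a) hmeas hC (mean_pos hη hν).le le_rfl ν 0 (v := 0)
  rw [zero_mul, add_zero, add_zero] at h1
  rw [← h1]
  congr 1
  ext x
  rw [cutLine_eq_hinge hν]
  ring

lemma isPLRep_twoPiece (hη : 0 < η) (hν : 0 < ν) (hσ : mean η ν ^ 2 < second ν β)
    (hx0 : 0 ≤ x₁) (hx : x₁ < mean η ν) :
    IsPLRep a 2 (twoPiece a η ν β x₁) ![a, x₁ + a, farPoint η ν β x₁ + a]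
      ![η + ν * a, η - ν * x₁ + ν * farWeight η ν β x₁ * (a + x₁)]
      ![-ν, -(ν * farWeight η ν β x₁)] where
  continuousOn := by
    rw [funext (twoPiece_eq_hinge (a := a) hν hσ hx)]
    exact (((continuous_hinge _).const_mul _).add ((continuous_hinge _).const_mul _)).continuousOn
  nonneg := (feasible_twoPiece hη hν hσ hx0 hx).nonneg
  start := rfl
  mono := by
    have h2 := mean_lt_farPoint hσ hx
    rw [Fin.monotone_iff_le_succ]
    intro i
    fin_cases i
    · simpa using hx0
    · simpa using (hx.trans h2).le
  linear := by
    have h2 := mean_lt_farPoint hσ hx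
    intro j x hxj
    fin_cases j
    · have h3 : x ≤ x₁ + a := by simpa using hxj.2
      simp [twoPiece, h3]
      ring
    · have h3 : x₁ + a ≤ x := by simpa using hxj.1
      have h4 : x ≤ farPoint η ν β x₁ + a := by simpa using hxj.2
      rcases h3.eq_or_lt with rfl | h3
      · simp [twoPiece]
        ring
      · simp [twoPiece, h3.not_ge, h4]
        ring
  vanish := by
    have h2 := mean_lt_farPoint hσ hx
    intro x hxl
    have h3 : farPoint η ν β x₁ + a < x := by simpa using hxl
    simp [twoPiece, h3.not_ge, (show ¬ x ≤ x₁ + a by linarith)]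

lemma cutLine_mem_PLPlus (hη : 0 < η) (hν : 0 < ν) : cutLine a η ν ∈ PLPlus a 2 := by
  have hμ := mean_pos hη hν
  have hm := mul_mean (η := η) hν
  have heq := cutLine_eq_hinge (a := a) (η := η) hν
  refine ⟨![a, mean η ν + a, mean η ν + a], ![η + ν * a, 0], ![-ν, 0], ?_, ?_, rfl, ?_, ?_, ?_⟩
  · rw [funext heq]
    exact ((continuous_hinge _).const_mul _).continuousOn
  · intro x _
    rw [heq]
    exact mul_nonneg hν.le (hinge_nonneg _ _)
  · rw [Fin.monotone_iff_le_succ]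
    intro i
    fin_cases i
    · simpa using hμ.le
    · simp
  · intro j x hxj
    fin_cases j
    · have h3 : x ≤ mean η ν + a := by simpa using hxj.2
      simp [cutLine, h3]
      ring
    · have h3 : mean η ν + a ≤ x := by simpa using hxj.1
      rw [heq, hinge_of_ge (by linarith)]
      simp
  · intro x hxl
    have h3 : mean η ν + a < x := by simpa using hxl
    simp [cutLine, h3.not_ge]

end

/-! ### Asymptotics of `H` and continuity of `W` -/

section

variable {a η ν β : ℝ} {h : ℝ → ℝ}

lemma intervalIntegrable_of_bounded (hmeas : Measurable h) {C : ℝ} (hC : ∀ x, |h x| ≤ C)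
    (u v : ℝ) : IntervalIntegrable h volume u v :=
  (intervalIntegrable_const (c := C)).mono_fun hmeas.aestronglyMeasurable
    (ae_of_all _ fun x => (hC x).trans (le_abs_self C))

lemma continuous_H (hmeas : Measurable h) {C : ℝ} (hC : ∀ x, |h x| ≤ C) (a : ℝ) :
    Continuous (H a h) := by
  have hm : Measurable fun v => h (v + a) := hmeas.comp (measurable_id.add_const a)
  have h1 : Continuous fun u => ∫ v in (0 : ℝ)..u, h (v + a) :=
    intervalIntegral.continuous_primitive
      (fun u v => intervalIntegrable_of_bounded hm (fun x => hC _) u v) 0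
  exact intervalIntegral.continuous_primitive (fun u v => h1.intervalIntegrable u v) 0

/-- Substituting `v = x s` turns the quotient into `∫₀¹ h(x s + a) (1 - s) ds`; dominated
convergence applies, and `∫₀¹ (1 - s) ds = 1/2`. -/
lemma tendsto_H_div_sq (hmeas : Measurable h) {C : ℝ} (hC : ∀ x, |h x| ≤ C) {L : ℝ}
    (hL : Tendsto h atTop (𝓝 L)) (a : ℝ) :
    Tendsto (fun x => H a h x / x ^ 2) atTop (𝓝 (L / 2)) := by
  have h1 : ∀ x : ℝ, 0 < x →
      ∫ s in (0 : ℝ)..1, h (x * s + a) * (1 - s) = H a h x / x ^ 2 := by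
    intro x hx
    unfold H
    rw [integral_primitive_eq (k := fun v => h (v + a)) (hmeas.comp (measurable_id.add_const a))
      (fun x => hC (x + a)) hx.le]
    have h2 := intervalIntegral.integral_comp_mul_left (a := 0) (b := 1)
      (fun v => h (v + a) * (x - v)) hx.ne'
    rw [mul_zero, mul_one, smul_eq_mul] at h2
    rw [eq_div_iff (by positivity), pow_two, ← mul_assoc, mul_comm, mul_comm _ x,
      ← intervalIntegral.integral_const_mul]
    have h3 : ∀ s : ℝ, x * (h (x * s + a) * (1 - s)) = h (x * s + a) * (x - x * s) := by
      intro s; ring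
    simp only [h3]
    rw [h2, ← mul_assoc, mul_inv_cancel₀ hx.ne', one_mul]
  have hlim : ∫ s in (0 : ℝ)..1, L * (1 - s) = L / 2 := by
    rw [intervalIntegral.integral_const_mul, intervalIntegral.integral_sub (by simp) (by simp)]
    simp
    ring
  rw [← hlim]
  refine Tendsto.congr' ((eventually_gt_atTop 0).mono fun x hx => h1 x hx) ?_
  refine intervalIntegral.tendsto_integral_filter_of_dominated_convergence (fun _ => C) ?_ ?_ ?_ ?_
  · refine Eventually.of_forall fun x => Measurable.aestronglyMeasurable ?_
    exact (hmeas.comp ((measurable_id.const_mul x).add_const a)).mul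
      (measurable_const.sub measurable_id)
  · refine Eventually.of_forall fun x => ae_of_all _ fun s hs => ?_
    rw [uIoc_of_le zero_le_one] at hs
    rw [norm_mul, Real.norm_eq_abs, Real.norm_of_nonneg (by linarith [hs.2])]
    exact (mul_le_of_le_one_right (abs_nonneg _) (by linarith [hs.1])).trans (hC _)
  · exact intervalIntegrable_const
  · refine ae_of_all _ fun s hs => ?_
    rw [uIoc_of_le zero_le_one] at hs
    refine Tendsto.mul_const _ (hL.comp ?_)
    exact tendsto_atTop_add_const_right _ _ (tendsto_id.atTop_mul_const hs.1)

/-- A bounded function that is eventually monotone or antitone has a limit at infinity. -/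
lemma IsRegular.exists_tendsto (hreg : IsRegular a h) : ∃ L : ℝ, Tendsto h atTop (𝓝 L) := by
  obtain ⟨C, hC⟩ := hreg.bounded
  obtain ⟨c, hac, hmono, hanti⟩ := hreg.unimodal
  induction c using EReal.rec with
  | bot => simp at hac
  | top =>
    have hm : Monotone fun x => h (max x a) := fun x y hxy =>
      hmono ⟨le_max_right _ _, EReal.coe_lt_top _⟩ ⟨le_max_right _ _, EReal.coe_lt_top _⟩
        (max_le_max_right _ hxy)
    refine ⟨_, (tendsto_atTop_ciSup hm ⟨C, ?_⟩).congr' ?_⟩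
    · rintro _ ⟨x, rfl⟩
      exact hC _
    · filter_upwards [eventually_ge_atTop a] with x hx
      rw [max_eq_left hx]
  | coe c =>
    have hmem : ∀ x : ℝ, max x (c + 1) ∈ {x : ℝ | (c : EReal) < x} := fun x =>
      EReal.coe_lt_coe_iff.2 ((lt_add_one c).trans_le (le_max_right _ _))
    have hm : Antitone fun x => h (max x (c + 1)) := fun x y hxy =>
      hanti (hmem x) (hmem y) (max_le_max_right _ hxy)
    refine ⟨_, (tendsto_atTop_ciInf hm ⟨0, ?_⟩).congr' ?_⟩
    · rintro _ ⟨x, rfl⟩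
      exact hreg.nonneg _
    · filter_upwards [eventually_ge_atTop (c + 1)] with x hx
      rw [max_eq_left hx]

lemma tendsto_farPoint (hσ : mean η ν ^ 2 < second ν β) :
    Tendsto (farPoint η ν β) (𝓝[<] (mean η ν)) atTop := by
  unfold farPoint
  have h1 : Tendsto (fun x => second ν β - mean η ν * x) (𝓝[<] (mean η ν))
      (𝓝 (second ν β - mean η ν * mean η ν)) :=
    (Continuous.tendsto (by fun_prop) _).mono_left nhdsWithin_le_nhds
  have h2 : Tendsto (fun x => mean η ν - x) (𝓝[<] (mean η ν)) (𝓝[>] 0) := by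
    refine tendsto_nhdsWithin_iff.2 ⟨?_, ?_⟩
    · have : Continuous fun x => mean η ν - x := by fun_prop
      simpa using (this.tendsto (mean η ν)).mono_left (nhdsWithin_le_nhds (s := Iio (mean η ν)))
    · filter_upwards [self_mem_nhdsWithin] with x hx
      exact mem_Ioi.2 (sub_pos.2 (mem_Iio.1 hx))
  exact h1.pos_mul_atTop (by nlinarith) (tendsto_inv_nhdsGT_zero.comp h2)

lemma continuous_nearWeight (hσ : mean η ν ^ 2 < second ν β) :
    Continuous (nearWeight η ν β) := by
  unfold nearWeight
  exact Continuous.div (by fun_prop) (by fun_prop) fun x => (denom_pos hσ x).ne'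

lemma continuous_farWeight (hσ : mean η ν ^ 2 < second ν β) :
    Continuous (farWeight η ν β) := by
  unfold farWeight
  exact Continuous.div (by fun_prop) (by fun_prop) fun x => (denom_pos hσ x).ne'

lemma nearWeight_mean (hσ : mean η ν ^ 2 < second ν β) : nearWeight η ν β (mean η ν) = 1 := by
  unfold nearWeight
  rw [div_eq_one_iff_eq (denom_pos hσ _).ne']
  ring

lemma farWeight_mean : farWeight η ν β (mean η ν) = 0 := by
  simp [farWeight]

lemma farWeight_mul_farPoint_sq (hσ : mean η ν ^ 2 < second ν β) {x : ℝ} (hx : x < mean η ν) :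
    farWeight η ν β x * farPoint η ν β x ^ 2 = second ν β - nearWeight η ν β x * x ^ 2 := by
  linear_combination weights_second_moment hσ hx

/-- The far term is a vanishing weight times a possibly unbounded value of `H`. Writing it as
(weight times far point squared) times `H / x²` at the far point separates two convergent factors,
with limits `σ - μ²` and `λ`. -/
lemma tendsto_W (hmeas : Measurable h) {C : ℝ} (hC : ∀ x, |h x| ≤ C)
    (hσ : mean η ν ^ 2 < second ν β) {lam : ℝ}
    (hlam : Tendsto (fun x => H a h x / x ^ 2) atTop (𝓝 lam)) :
    Tendsto (W a η ν β h lam) (𝓝[<] (mean η ν)) (𝓝 (W a η ν β h lam (mean η ν))) := by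
  have hn := continuous_nearWeight hσ
  have h1 : Tendsto (fun x => ν * (nearWeight η ν β x * H a h x
      + (second ν β - nearWeight η ν β x * x ^ 2)
        * (H a h (farPoint η ν β x) / farPoint η ν β x ^ 2))) (𝓝[<] (mean η ν))
      (𝓝 (ν * (nearWeight η ν β (mean η ν) * H a h (mean η ν)
        + (second ν β - nearWeight η ν β (mean η ν) * mean η ν ^ 2) * lam))) := by
    refine Tendsto.const_mul _ (Tendsto.add ?_ (Tendsto.mul ?_ (hlam.comp (tendsto_farPoint hσ))))
    · exact ((hn.mul (continuous_H hmeas hC a)).tendsto _).mono_left nhdsWithin_le_nhds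
    · exact ((continuous_const.sub (hn.mul (continuous_pow 2))).tendsto _).mono_left
        nhdsWithin_le_nhds
  rw [nearWeight_mean hσ, one_mul, one_mul, mul_comm _ lam] at h1
  rw [W, if_pos rfl]
  refine h1.congr' ?_
  filter_upwards [self_mem_nhdsWithin,
    (tendsto_farPoint hσ).eventually (eventually_gt_atTop 0)] with x hx hpos
  rw [W, if_neg (ne_of_lt hx), ← farWeight_mul_farPoint_sq hσ hx]
  field_simp

lemma continuousOn_W (hmeas : Measurable h) {C : ℝ} (hC : ∀ x, |h x| ≤ C)
    (hσ : mean η ν ^ 2 < second ν β) {lam : ℝ}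
    (hlam : Tendsto (fun x => H a h x / x ^ 2) atTop (𝓝 lam)) :
    ContinuousOn (W a η ν β h lam) (Iic (mean η ν)) := by
  intro x hx
  rcases (mem_Iic.1 hx).eq_or_lt with rfl | hx
  · rw [← Iio_insert, continuousWithinAt_insert_self]
    exact tendsto_W hmeas hC hσ hlam
  · refine ContinuousAt.continuousWithinAt ?_
    have hfar : ContinuousAt (farPoint η ν β) x := by
      unfold farPoint
      exact ContinuousAt.div (by fun_prop) (by fun_prop) (sub_pos.2 hx).ne'
    have hH := continuous_H hmeas hC a
    have h1 : ContinuousAt (fun x => ν * (nearWeight η ν β x * H a h x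
        + farWeight η ν β x * H a h (farPoint η ν β x))) x :=
      continuousAt_const.mul (((continuous_nearWeight hσ).mul hH).continuousAt.add
        ((continuous_farWeight hσ).continuousAt.mul (hH.continuousAt.comp hfar)))
    refine h1.congr ?_
    filter_upwards [Iio_mem_nhds hx] with y hy
    rw [W, if_neg (ne_of_lt hy)]

end

/-! ### Comparison with a two-piece tail of equal mass beyond the mode -/

section

variable {a η ν β c x₁ : ℝ} {f h : ℝ → ℝ}

lemma Feasible.continuousOn_Ici (hf : Feasible a η ν β f) : ContinuousOn f (Ici a) := by
  intro x hx
  rcases (mem_Ici.1 hx).eq_or_lt with rfl | hx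
  · rw [← Ioi_insert, continuousWithinAt_insert_self, ContinuousWithinAt, hf.value]
    exact hf.right_limit
  · exact (hf.continuousOn.continuousAt (Ioi_mem_nhds hx)).continuousWithinAt

/-- A convex function that has once increased keeps increasing. With `-k` the slope of the second
piece of a two-piece tail, adding `k x` makes that piece constant, so the lemma controls how `f` can
cross it. -/
lemma ConvexOn.add_linear_lt (hf : ConvexOn ℝ (Ici a) f) (k : ℝ) {x y z : ℝ} (hx : a ≤ x)
    (hxy : x < y) (hyz : y < z) (hlt : f x + k * x < f y + k * y) :
    f y + k * y < f z + k * z := by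
  have h1 := hf.slope_mono_adjacent (mem_Ici.2 hx) (mem_Ici.2 (hx.trans (hxy.trans hyz).le))
    hxy hyz
  have h2 : -k < (f y - f x) / (y - x) := by
    rw [lt_div_iff₀ (sub_pos.2 hxy)]
    linarith
  have h3 := h2.trans_le h1
  rw [lt_div_iff₀ (sub_pos.2 hyz)] at h3
  linarith

lemma ConvexOn.add_linear_le (hf : ConvexOn ℝ (Ici a) f) (k : ℝ) {x y z : ℝ} (hx : a ≤ x)
    (hxy : x < y) (hyz : y < z) (hle : f x + k * x ≤ f y + k * y) :
    f y + k * y ≤ f z + k * z := by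
  have h1 := hf.slope_mono_adjacent (mem_Ici.2 hx) (mem_Ici.2 (hx.trans (hxy.trans hyz).le))
    hxy hyz
  have h2 : -k ≤ (f y - f x) / (y - x) := by
    rw [le_div_iff₀ (sub_pos.2 hxy)]
    linarith
  have h3 := h2.trans h1
  rw [le_div_iff₀ (sub_pos.2 hyz)] at h3
  linarith

lemma integral_Ioi_eq_add {g : ℝ → ℝ} (hg : IntegrableOn g (Ioi a)) (hac : a ≤ c) :
    ∫ x in Ioi a, g x = (∫ x in Ioc a c, g x) + ∫ x in Ioi c, g x := by
  rw [← Ioc_union_Ioi_eq_Ioi hac, setIntegral_union (Ioc_disjoint_Ioi le_rfl) measurableSet_Ioi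
    (hg.mono_set Ioc_subset_Ioi_self) (hg.mono_set (Ioi_subset_Ioi hac))]

lemma twoPiece_add_linear (hν : 0 < ν) (hσ : mean η ν ^ 2 < second ν β)
    (hx : x₁ < mean η ν) {x : ℝ} (hx1 : a + x₁ ≤ x) (hx2 : x ≤ a + farPoint η ν β x₁) :
    twoPiece a η ν β x₁ x + ν * farWeight η ν β x₁ * x
      = ν * farWeight η ν β x₁ * (a + farPoint η ν β x₁) := by
  rw [twoPiece_eq_hinge hν hσ hx, hinge_of_ge hx1, hinge_of_le hx2]
  ring

lemma twoPiece_of_ge (hν : 0 < ν) (hσ : mean η ν ^ 2 < second ν β)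
    (hx : x₁ < mean η ν) {x : ℝ} (hx2 : a + farPoint η ν β x₁ ≤ x) :
    twoPiece a η ν β x₁ x = 0 := by
  have := mean_lt_farPoint hσ hx
  rw [twoPiece_eq_hinge hν hσ hx, hinge_of_ge (by linarith), hinge_of_ge hx2]
  ring

lemma Feasible.twoPiece_le (hf : Feasible a η ν β f) {x : ℝ} (hx : a ≤ x) (hx1 : x ≤ a + x₁) :
    twoPiece a η ν β x₁ x ≤ f x := by
  rw [twoPiece, if_pos (by linarith)]
  exact hf.tangent_le hx

lemma continuous_twoPiece (hν : 0 < ν) (hσ : mean η ν ^ 2 < second ν β)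
    (hx : x₁ < mean η ν) : Continuous (twoPiece a η ν β x₁) := by
  rw [funext (twoPiece_eq_hinge (a := a) hν hσ hx)]
  exact ((continuous_hinge _).const_mul _).add ((continuous_hinge _).const_mul _)

lemma Feasible.setIntegral_Ioc_eq {g : ℝ → ℝ} (hf : Feasible a η ν β f)
    (hg : Feasible a η ν β g) (hac : a ≤ c)
    (htail : ∫ x in Ioi c, f x = ∫ x in Ioi c, g x) :
    ∫ x in Ioc a c, f x = ∫ x in Ioc a c, g x := by
  have h1 := integral_Ioi_eq_add hf.integrable hac
  have h2 := integral_Ioi_eq_add hg.integrable hac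
  rw [hf.mass] at h1
  rw [hg.mass] at h2
  linarith

/-- A two-piece tail that carries the same mass as `f` beyond the mode of `h`, and whose second
piece lies above `f` there, has an objective value at least that of `f`. -/
lemma objective_le_twoPiece (hη : 0 < η) (hν : 0 < ν) (hσ : mean η ν ^ 2 < second ν β)
    (hmeas : Measurable h) {C : ℝ} (h0 : ∀ x, 0 ≤ h x) (hC : ∀ x, h x ≤ C)
    (hmono : MonotoneOn h (Ico a c)) (hanti : AntitoneOn h (Ioi c))
    (hf : Feasible a η ν β f) (hx0 : 0 ≤ x₁) (hx : x₁ < mean η ν)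
    (hc1 : a + x₁ ≤ c) (hc2 : c ≤ a + farPoint η ν β x₁) (hfc : f c ≤ twoPiece a η ν β x₁ c)
    (htail : ∫ x in Ioi c, f x = ∫ x in Ioi c, twoPiece a η ν β x₁ x) :
    objective a h f ≤ objective a h (twoPiece a η ν β x₁) := by
  have hT := feasible_twoPiece (a := a) (β := β) hη hν hσ hx0 hx
  have hac : a ≤ c := by linarith
  have hCabs : ∀ x, |h x| ≤ C := fun x => by rw [abs_of_nonneg (h0 x)]; exact hC x
  set T := twoPiece a η ν β x₁ with hTdef
  set k := ν * farWeight η ν β x₁ with hk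
  have hhead := hf.setIntegral_Ioc_eq hT hac htail
  have haff : ∀ x, a + x₁ ≤ x → x ≤ a + farPoint η ν β x₁ →
      T x + k * x = k * (a + farPoint η ν β x₁) := fun x =>
    twoPiece_add_linear hν hσ hx
  have haffc := haff c hc1 hc2
  have hgi : IntegrableOn (fun x => T x - f x) (Ioi a) := hT.integrable.sub hf.integrable
  -- The interval is open because `h c` is unconstrained. Where `T > f` the point lies on the second
  -- piece, as `T` follows the tangent bound before its kink. If `f` then rose above `T` before `c`,
  -- it would stay above it up to `c`, against `f c ≤ T c`.
  have hlow : 0 ≤ ∫ x in Ioo a c, h x * (T x - f x) := by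
    refine setIntegral_mul_nonneg_of_crossing measurableSet_Ioo hmeas h0 hC
      (hgi.mono_set Ioo_subset_Ioi_self) ?_ ?_
    · rw [← integral_Ioc_eq_integral_Ioo, integral_sub (hT.integrable.mono_set Ioc_subset_Ioi_self)
        (hf.integrable.mono_set Ioc_subset_Ioi_self), hhead, sub_self]
    · intro x hxs y hys hxneg hypos
      refine hmono (Ioo_subset_Ico_self hxs) (Ioo_subset_Ico_self hys) ?_
      by_contra! hyx
      have hy1 : a + x₁ < y := by
        by_contra! hle
        linarith [hf.twoPiece_le hys.1.le hle]
      have hTy := haff y hy1.le (hys.2.le.trans hc2)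
      have hTx := haff x (hy1.le.trans hyx.le) (hxs.2.le.trans hc2)
      have := ConvexOn.add_linear_lt hf.convex k hys.1.le hyx hxs.2 (by linarith)
      linarith
  -- Here `f` starts at or below the second piece; once above, it stays above, and past the far
  -- point `T = 0 ≤ f`.
  have hhigh : 0 ≤ ∫ x in Ioi c, h x * (T x - f x) := by
    refine setIntegral_mul_nonneg_of_crossing measurableSet_Ioi hmeas h0 hC
      (hgi.mono_set (Ioi_subset_Ioi hac)) ?_ ?_
    · rw [integral_sub (hT.integrable.mono_set (Ioi_subset_Ioi hac))
        (hf.integrable.mono_set (Ioi_subset_Ioi hac)), htail, sub_self]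
    · intro x hxs y hys hxneg hypos
      have hxs' : c < x := hxs
      have hys' : c < y := hys
      refine hanti hys hxs ?_
      by_contra! hxy
      have hy2 : y < a + farPoint η ν β x₁ := by
        by_contra! hle
        have h1 : T y = 0 := twoPiece_of_ge hν hσ hx hle
        linarith [hf.nonneg y (by linarith)]
      have hTy := haff y (by linarith) hy2.le
      have hTx := haff x (by linarith) (by linarith)
      have := ConvexOn.add_linear_lt hf.convex k hac hxs' hxy (by linarith)
      linarith
  have hsum : objective a h T - objective a h f = ∫ x in Ioi a, h x * (T x - f x) := by
    unfold objective
    rw [← integral_sub (integrableOn_mul_of_bounded hmeas hCabs hT.integrable)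
      (integrableOn_mul_of_bounded hmeas hCabs hf.integrable)]
    simp only [mul_sub]
  rw [integral_Ioi_eq_add (integrableOn_mul_of_bounded hmeas hCabs hgi) hac,
    integral_Ioc_eq_integral_Ioo] at hsum
  linarith

/-- Twice the mass beyond `a + t` of the two-piece tail with kink at `a + x₁`, divided by `ν`. -/
noncomputable def tailMoment (η ν β t x₁ : ℝ) : ℝ :=
  nearWeight η ν β x₁ * max (x₁ - t) 0 ^ 2
    + max (second ν β - mean η ν * x₁ - t * (mean η ν - x₁)) 0 ^ 2
      / (second ν β - 2 * mean η ν * x₁ + x₁ ^ 2)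

/-- The definition has the far point multiplied out, so it makes sense at `μ` and the intermediate
value theorem applies on all of `[0, μ]`. -/
lemma continuous_tailMoment (hσ : mean η ν ^ 2 < second ν β) (t : ℝ) :
    Continuous (tailMoment η ν β t) := by
  unfold tailMoment
  exact ((continuous_nearWeight hσ).mul (by fun_prop)).add
    (Continuous.div (by fun_prop) (by fun_prop) fun x => (denom_pos hσ x).ne')

lemma tailMoment_eq (hx : x₁ < mean η ν) (t : ℝ) :
    tailMoment η ν β t x₁ = nearWeight η ν β x₁ * max (x₁ - t) 0 ^ 2
      + farWeight η ν β x₁ * max (farPoint η ν β x₁ - t) 0 ^ 2 := by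
  unfold tailMoment farWeight
  have h1 : max (second ν β - mean η ν * x₁ - t * (mean η ν - x₁)) 0
      = (mean η ν - x₁) * max (farPoint η ν β x₁ - t) 0 := by
    rw [mul_max_of_nonneg _ _ (sub_pos.2 hx).le, mul_zero, ← farPoint_eq hx]
    ring_nf
  rw [h1]
  ring

lemma integral_Ioi_twoPiece (hν : 0 < ν) (hσ : mean η ν ^ 2 < second ν β)
    (hx : x₁ < mean η ν) (c : ℝ) :
    ∫ x in Ioi c, twoPiece a η ν β x₁ x = ν / 2 * tailMoment η ν β (c - a) x₁ := by
  rw [funext (twoPiece_eq_hinge (a := a) hν hσ hx), integral_add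
    ((integrableOn_hinge _ _).const_mul _) ((integrableOn_hinge _ _).const_mul _),
    integral_const_mul, integral_const_mul, integral_hinge, integral_hinge, tailMoment_eq hx]
  unfold hinge
  rw [show a + x₁ - c = x₁ - (c - a) by ring,
    show a + farPoint η ν β x₁ - c = farPoint η ν β x₁ - (c - a) by ring]
  ring

lemma tailMoment_mean (hσ : mean η ν ^ 2 < second ν β) (t : ℝ) :
    tailMoment η ν β t (mean η ν)
      = max (mean η ν - t) 0 ^ 2 + (second ν β - mean η ν ^ 2) := by
  unfold tailMoment
  rw [nearWeight_mean hσ, sub_self, mul_zero, sub_zero, ← sq, max_eq_left (sub_pos.2 hσ).le]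
  have h1 : second ν β - 2 * mean η ν * mean η ν + mean η ν ^ 2 = second ν β - mean η ν ^ 2 := by
    ring
  have h2 : second ν β - mean η ν ^ 2 ≠ 0 := (sub_pos.2 hσ).ne'
  rw [h1]
  field_simp

/-- If the kink lies beyond `a + t` the tail mass no longer depends on it. -/
lemma tailMoment_of_le (hσ : mean η ν ^ 2 < second ν β) (hx : x₁ < mean η ν) {t : ℝ}
    (ht : t ≤ x₁) : tailMoment η ν β t x₁ = tailMoment η ν β t (mean η ν) := by
  have h2 := mean_lt_farPoint hσ hx
  have m0 := nearWeight_add_farWeight (x₁ := x₁) hσ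
  have m1 := weights_first_moment hσ hx
  have m2 := weights_second_moment hσ hx
  rw [tailMoment_mean hσ, tailMoment_eq hx, max_eq_left (by linarith), max_eq_left (by linarith),
    max_eq_left (by linarith)]
  linear_combination m2 - 2 * t * m1 + t ^ 2 * m0

lemma integral_Ioi_cutLine (hν : 0 < ν) (c : ℝ) :
    ∫ x in Ioi c, cutLine a η ν x = ν / 2 * max (mean η ν - (c - a)) 0 ^ 2 := by
  rw [funext (cutLine_eq_hinge (a := a) hν), integral_const_mul, integral_hinge]
  unfold hinge
  rw [show a + mean η ν - c = mean η ν - (c - a) by ring]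
  ring

lemma integrableOn_cutLine (hν : 0 < ν) (c : ℝ) : IntegrableOn (cutLine a η ν) (Ioi c) := by
  rw [funext (cutLine_eq_hinge (a := a) hν)]
  exact (integrableOn_hinge _ _).const_mul _

lemma continuous_cutLine (hν : 0 < ν) : Continuous (cutLine a η ν) := by
  rw [funext (cutLine_eq_hinge (a := a) hν)]
  exact (continuous_hinge _).const_mul _

lemma Feasible.cutLine_le (hν : 0 < ν) (hf : Feasible a η ν β f) {x : ℝ} (hx : a ≤ x) :
    cutLine a η ν x ≤ f x := by
  rw [cutLine_eq_hinge hν]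
  exact hf.hinge_le hν hx

lemma setIntegral_lt_of_lt {g₁ g₂ : ℝ → ℝ} {u v x : ℝ} (h1 : ContinuousOn g₁ (Icc u v))
    (h2 : ContinuousOn g₂ (Icc u v)) (huv : u < v) (hle : ∀ x ∈ Ioc u v, g₁ x ≤ g₂ x)
    (hx : x ∈ Icc u v) (hlt : g₁ x < g₂ x) :
    ∫ x in Ioc u v, g₁ x < ∫ x in Ioc u v, g₂ x := by
  have h3 := intervalIntegral.integral_lt_integral_of_continuousOn_of_le_of_exists_lt huv h1 h2 hle
    ⟨x, hx, hlt⟩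
  rwa [intervalIntegral.integral_of_le huv.le, intervalIntegral.integral_of_le huv.le] at h3

/-- Mass balance: the tail of `f` falls short of the limiting value at `μ` exactly by the excess of
`f` over the cut line before `c`. Thus that value is the largest possible tail mass. -/
lemma Feasible.tail_add_cutLine (hη : 0 < η) (hν : 0 < ν) (hf : Feasible a η ν β f)
    (hac : a ≤ c) (hσ : mean η ν ^ 2 < second ν β) :
    (∫ x in Ioi c, f x) + ((∫ x in Ioc a c, f x) - ∫ x in Ioc a c, cutLine a η ν x)
      = ν / 2 * tailMoment η ν β (c - a) (mean η ν) := by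
  have h1 := integral_Ioi_eq_add hf.integrable hac
  have h2 := integral_Ioi_eq_add (integrableOn_cutLine (a := a) (η := η) hν a) hac
  rw [integral_Ioi_cutLine hν, integral_Ioi_cutLine hν, sub_self, sub_zero,
    max_eq_left (mean_pos hη hν).le] at h2
  rw [hf.mass] at h1
  rw [tailMoment_mean hσ]
  have := mul_second (β := β) hν
  linear_combination -h1 + h2 - this / 2

/-- Among two-piece tails, the straight line carries the least mass beyond any point. -/
lemma Feasible.tailMoment_zero_le (hη : 0 < η) (hν : 0 < ν) (hσ : mean η ν ^ 2 < second ν β)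
    (hf : Feasible a η ν β f) (hac : a ≤ c) :
    ν / 2 * tailMoment η ν β (c - a) 0 ≤ ∫ x in Ioi c, f x := by
  have hμ := mean_pos hη hν
  have hT := feasible_twoPiece (a := a) (β := β) hη hν hσ le_rfl hμ
  rw [← integral_Ioi_twoPiece hν hσ hμ]
  have haff : ∀ x, a ≤ x → x ≤ a + farPoint η ν β 0 →
      twoPiece a η ν β 0 x + ν * farWeight η ν β 0 * x
        = ν * farWeight η ν β 0 * (a + farPoint η ν β 0) := fun x hx =>
    twoPiece_add_linear hν hσ hμ (by linarith)
  set T := twoPiece a η ν β 0 with hTdef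
  set k := ν * farWeight η ν β 0 with hk
  have hfar := mean_lt_farPoint hσ hμ
  have haffa := haff a le_rfl (by linarith)
  have hTa := hT.value
  have hfa := hf.value
  rcases hac.eq_or_lt with rfl | hac'
  · rw [hf.mass, hT.mass]
  -- Both tails start at `η` and `T` is a line until it vanishes. If `f` is not below `T` at `c` it
  -- dominates `T` beyond; otherwise it lies below `T` before `c`, and equal total mass gives the
  -- claim.
  rcases le_or_gt (T c) (f c) with hle | hlt
  · refine setIntegral_mono_on (hT.integrable.mono_set (Ioi_subset_Ioi hac))
      (hf.integrable.mono_set (Ioi_subset_Ioi hac)) measurableSet_Ioi fun y hy => ?_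
    have hy' : c < y := hy
    rcases le_total (a + farPoint η ν β 0) y with hfy | hfy
    · rw [hTdef, twoPiece_of_ge hν hσ hμ hfy]
      exact hf.nonneg y (by linarith)
    · have hTy := haff y (by linarith) hfy
      have hTc := haff c hac (by linarith)
      have := ConvexOn.add_linear_le hf.convex k le_rfl hac' hy' (by linarith)
      linarith
  · have hcfar : c ≤ a + farPoint η ν β 0 := by
      by_contra! hgt
      have : T c = 0 := twoPiece_of_ge hν hσ hμ hgt.le
      linarith [hf.nonneg c hac]
    have hTc := haff c hac hcfar
    have hhead : ∫ x in Ioc a c, f x ≤ ∫ x in Ioc a c, T x := by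
      refine setIntegral_mono_on (hf.integrable.mono_set Ioc_subset_Ioi_self)
        (hT.integrable.mono_set Ioc_subset_Ioi_self) measurableSet_Ioc fun y hy => ?_
      rcases hy.2.eq_or_lt with rfl | hyc
      · exact hlt.le
      have hTy := haff y hy.1.le (by linarith)
      by_contra! hgt
      have := ConvexOn.add_linear_lt hf.convex k le_rfl hy.1 hyc (by linarith)
      linarith
    have h1 := integral_Ioi_eq_add hf.integrable hac
    have h2 := integral_Ioi_eq_add hT.integrable hac
    rw [hf.mass] at h1
    rw [hT.mass] at h2
    linarith

lemma Feasible.eq_zero_of_tail_eq_zero (hf : Feasible a η ν β f) (hac : a ≤ c)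
    (h0 : ∫ x in Ioi c, f x = 0) : f c = 0 := by
  by_contra hne
  have hpos : 0 < f c := lt_of_le_of_ne (hf.nonneg c hac) (Ne.symm hne)
  have h1 := integral_Ioi_eq_add (hf.integrable.mono_set (Ioi_subset_Ioi hac))
    (show c ≤ c + 1 by linarith)
  have h2 : 0 ≤ ∫ x in Ioi (c + 1), f x :=
    setIntegral_nonneg measurableSet_Ioi fun x hx => hf.nonneg x (by linarith [mem_Ioi.1 hx])
  have h3 := setIntegral_lt_of_lt (g₁ := fun _ => 0) (g₂ := f) (u := c) (v := c + 1) (x := c)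
    continuousOn_const (hf.continuousOn_Ici.mono fun x hx => mem_Ici.2 (hac.trans hx.1))
    (by linarith) (fun x hx => hf.nonneg x (hac.trans hx.1.le)) ⟨le_rfl, by linarith⟩ hpos
  simp only [integral_zero] at h3
  linarith

/-- For every feasible `f` and every `c` there is a two-piece tail with the same mass beyond `c`
whose second piece lies above `f` at `c`. -/
lemma Feasible.exists_twoPiece (hη : 0 < η) (hν : 0 < ν) (hσ : mean η ν ^ 2 < second ν β)
    (hf : Feasible a η ν β f) (hac : a ≤ c) :
    ∃ x₁, 0 ≤ x₁ ∧ x₁ < mean η ν ∧ a + x₁ ≤ c ∧ c ≤ a + farPoint η ν β x₁ ∧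
      f c ≤ twoPiece a η ν β x₁ c ∧
      ∫ x in Ioi c, f x = ∫ x in Ioi c, twoPiece a η ν β x₁ x := by
  have hμ := mean_pos hη hν
  have htop := hf.tail_add_cutLine hη hν hac hσ
  have hbot := hf.tailMoment_zero_le hη hν hσ hac
  have hcutle : ∫ x in Ioc a c, cutLine a η ν x ≤ ∫ x in Ioc a c, f x :=
    setIntegral_mono_on ((integrableOn_cutLine hν a).mono_set Ioc_subset_Ioi_self)
      (hf.integrable.mono_set Ioc_subset_Ioi_self) measurableSet_Ioc
      fun x hx => hf.cutLine_le hν hx.1.le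
  have htpos : 0 < tailMoment η ν β (c - a) (mean η ν) := by
    rw [tailMoment_mean hσ]
    have := sub_pos.2 hσ
    positivity
  have htail0 : 0 ≤ ∫ x in Ioi c, f x :=
    setIntegral_nonneg measurableSet_Ioi fun x hx => hf.nonneg x (hac.trans (le_of_lt hx))
  -- Maximal tail mass leaves `f` no excess over the cut line before `c`. Then `c < a + μ`, and the
  -- kink is put at `c` itself.
  by_cases hL : ∫ x in Ioi c, f x = ν / 2 * tailMoment η ν β (c - a) (mean η ν)
  · have hfc : f c ≤ cutLine a η ν c := by
      by_contra! hlt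
      rcases hac.eq_or_lt with rfl | hac'
      · rw [hf.value, cutLine, if_pos (by linarith)] at hlt
        linarith
      · have := setIntegral_lt_of_lt (continuous_cutLine hν).continuousOn
          (hf.continuousOn_Ici.mono Icc_subset_Ici_self) hac'
          (fun x hx => hf.cutLine_le hν hx.1.le) ⟨hac, le_rfl⟩ hlt
        linarith
    have hcμ : c - a < mean η ν := by
      by_contra! hge
      have h0 : cutLine a η ν c = 0 := by
        rw [cutLine_eq_hinge hν, hinge_of_ge (by linarith), mul_zero]
      have hfc0 : f c = 0 := le_antisymm (h0 ▸ hfc) (hf.nonneg c hac)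
      have h1 : ∫ x in Ioi c, f x = 0 := by
        rw [setIntegral_congr_fun (g := fun _ => (0 : ℝ)) measurableSet_Ioi
          fun x hx => hf.eq_zero_of_le hac (le_of_lt hx) hfc0]
        simp
      rw [h1] at hL
      have := mul_pos (half_pos hν) htpos
      linarith
    have hfar := mean_lt_farPoint hσ hcμ
    refine ⟨c - a, sub_nonneg.2 hac, hcμ, by linarith, by linarith, ?_, ?_⟩
    · rw [cutLine, if_pos (by linarith)] at hfc
      rwa [twoPiece, if_pos (by linarith)]
    · rw [hL, integral_Ioi_twoPiece hν hσ hcμ, tailMoment_of_le hσ hcμ le_rfl]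
  have hlt : ∫ x in Ioi c, f x < ν / 2 * tailMoment η ν β (c - a) (mean η ν) :=
    lt_of_le_of_ne (by linarith) hL
  have hac' : a < c := by
    refine lt_of_le_of_ne hac fun h => ?_
    subst h
    simp at htop
    exact hL (by simpa using htop)
  -- If `f` vanishes beyond `c`, the kink is obtained by solving `farPoint = c - a`.
  by_cases hR : ∫ x in Ioi c, f x = 0
  · have hfc := hf.eq_zero_of_tail_eq_zero hac hR
    rw [hR] at hbot
    have hden := denom_pos hσ (0 : ℝ)
    have hσpos : 0 < second ν β := by simpa using hden
    have h1 : second ν β ≤ (c - a) * mean η ν := by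
      by_contra! hgt
      have h2 : 0 < tailMoment η ν β (c - a) 0 := by
        unfold tailMoment
        have h3 : 0 < max (second ν β - mean η ν * 0 - (c - a) * (mean η ν - 0)) 0 :=
          lt_max_of_lt_left (by linarith)
        have h4 := nearWeight_pos (x₁ := 0) hσ
        positivity
      have := mul_pos (half_pos hν) h2
      linarith
    have h2 : mean η ν < c - a := by nlinarith
    have h3 : 0 < c - a - mean η ν := sub_pos.2 h2
    set x₁ := ((c - a) * mean η ν - second ν β) / (c - a - mean η ν) with hx₁
    have hx0 : 0 ≤ x₁ := div_nonneg (by linarith) h3.le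
    have hxμ : x₁ < mean η ν := by
      rw [hx₁, div_lt_iff₀ h3]
      nlinarith
    have hmul : x₁ * (c - a - mean η ν) = (c - a) * mean η ν - second ν β :=
      div_mul_cancel₀ _ h3.ne'
    have hfar : farPoint η ν β x₁ = c - a := by
      unfold farPoint
      rw [div_eq_iff (sub_pos.2 hxμ).ne']
      linear_combination hmul
    refine ⟨x₁, hx0, hxμ, by linarith, by linarith, ?_, ?_⟩
    · rw [hfc]
      exact (feasible_twoPiece hη hν hσ hx0 hxμ).nonneg c hac
    · rw [hR, integral_Ioi_twoPiece hν hσ hxμ, tailMoment_eq hxμ, hfar,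
        max_eq_right (by linarith), max_eq_right (by linarith)]
      simp
  have hpos : 0 < ∫ x in Ioi c, f x := lt_of_le_of_ne htail0 (Ne.symm hR)
  -- The tail mass of `f` lies between those at kinks `0` and `μ`. Its being neither maximal nor
  -- zero places `c` between the kink and the far point.
  obtain ⟨x₁, ⟨hx0, hxμ⟩, hxeq⟩ := intermediate_value_Icc hμ.le
    ((continuous_tailMoment hσ (c - a)).const_mul (ν / 2)).continuousOn ⟨hbot, hlt.le⟩
  simp only at hxeq
  have hxμ' : x₁ < mean η ν := lt_of_le_of_ne hxμ fun h => by
    rw [h] at hxeq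
    linarith
  have htail : ∫ x in Ioi c, f x = ∫ x in Ioi c, twoPiece a η ν β x₁ x := by
    rw [integral_Ioi_twoPiece hν hσ hxμ', hxeq]
  have hc1 : a + x₁ ≤ c := by
    by_contra! hgt
    rw [tailMoment_of_le hσ hxμ' (by linarith)] at hxeq
    linarith
  have hc2 : c ≤ a + farPoint η ν β x₁ := by
    by_contra! hgt
    rw [tailMoment_eq hxμ', max_eq_right (by linarith), max_eq_right (by linarith)] at hxeq
    simp at hxeq
    linarith
  refine ⟨x₁, hx0, hxμ', hc1, hc2, ?_, htail⟩
  have hT := feasible_twoPiece (a := a) (β := β) hη hν hσ hx0 hxμ'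
  have haff : ∀ x, a + x₁ ≤ x → x ≤ a + farPoint η ν β x₁ →
      twoPiece a η ν β x₁ x + ν * farWeight η ν β x₁ * x
        = ν * farWeight η ν β x₁ * (a + farPoint η ν β x₁) := fun x =>
    twoPiece_add_linear hν hσ hxμ'
  have hTcont := continuous_twoPiece (a := a) hν hσ hxμ'
  have hzero : ∀ x, a + farPoint η ν β x₁ ≤ x → twoPiece a η ν β x₁ x = 0 := fun x =>
    twoPiece_of_ge hν hσ hxμ'
  have hTle : ∀ x, a ≤ x → x ≤ a + x₁ → twoPiece a η ν β x₁ x ≤ f x := fun x => hf.twoPiece_le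
  have hhead := hf.setIntegral_Ioc_eq hT hac htail
  set T := twoPiece a η ν β x₁
  set k := ν * farWeight η ν β x₁
  have hTc := haff c hc1 hc2
  -- If `f c > T c`, then either `f ≥ T` all the way up to `c`, contradicting equal mass before `c`,
  -- or `f` was below `T` earlier and has crossed it upwards, so `f ≥ T` beyond `c`, contradicting
  -- equal mass there.
  by_contra! hgt
  by_cases hleft : ∀ x ∈ Ioc a c, T x ≤ f x
  · have := setIntegral_lt_of_lt hTcont.continuousOn
      (hf.continuousOn_Ici.mono Icc_subset_Ici_self) hac' hleft ⟨hac, le_rfl⟩ hgt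
    linarith
  · push Not at hleft
    obtain ⟨y, hy, hyT⟩ := hleft
    have hyc : y < c := lt_of_le_of_ne hy.2 fun h => by rw [h] at hyT; linarith
    have hy1 : a + x₁ < y := by
      by_contra! hle
      linarith [hTle y hy.1.le hle]
    have hTy := haff y hy1.le (by linarith)
    have hright : ∀ x, c ≤ x → T x ≤ f x := by
      intro x hcx
      rcases hcx.eq_or_lt with rfl | hcx
      · exact hgt.le
      rcases le_total (a + farPoint η ν β x₁) x with hfx | hfx
      · rw [hzero x hfx]
        exact hf.nonneg x (by linarith)
      · have hTx := haff x (by linarith) hfx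
        have := ConvexOn.add_linear_lt hf.convex k hy.1.le hyc hcx (by linarith)
        linarith
    have hi1 := hf.integrable.mono_set (Ioi_subset_Ioi hac)
    have hi2 := hT.integrable.mono_set (Ioi_subset_Ioi hac)
    have h1 := integral_Ioi_eq_add hi1 (show c ≤ c + 1 by linarith)
    have h2 := integral_Ioi_eq_add hi2 (show c ≤ c + 1 by linarith)
    have h3 := setIntegral_lt_of_lt (v := c + 1) hTcont.continuousOn
      (hf.continuousOn_Ici.mono fun x hx => mem_Ici.2 (hac.trans hx.1)) (by linarith)
      (fun x hx => hright x hx.1.le) ⟨le_rfl, by linarith⟩ hgt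
    have h4 : ∫ x in Ioi (c + 1), T x ≤ ∫ x in Ioi (c + 1), f x :=
      setIntegral_mono_on (hi2.mono_set (Ioi_subset_Ioi (by linarith)))
        (hi1.mono_set (Ioi_subset_Ioi (by linarith))) measurableSet_Ioi
        fun x hx => hright x (by linarith [mem_Ioi.1 hx])
    linarith

end

/-! ### Every feasible value is bounded by `W` -/

section

variable {a η ν β : ℝ} {f h : ℝ → ℝ}

/-- For nondecreasing `h`, a feasible `f` whose value exceeds that of all two-piece tails stays
strictly below the limiting value at `μ`. -/
lemma Feasible.objective_le_or_lt_of_monotoneOn (hη : 0 < η) (hν : 0 < ν)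
    (hσ : mean η ν ^ 2 < second ν β) (hmeas : Measurable h) {C : ℝ} (h0 : ∀ x, 0 ≤ h x)
    (hC : ∀ x, h x ≤ C) (hmono : MonotoneOn h (Ici a)) {L : ℝ} (hL : Tendsto h atTop (𝓝 L))
    (hf : Feasible a η ν β f) :
    (∃ x₁ ∈ Ico 0 (mean η ν), objective a h f ≤ objective a h (twoPiece a η ν β x₁)) ∨
      objective a h f < W a η ν β h (L / 2) (mean η ν) := by
  have hμ := mean_pos hη hν
  have hCabs : ∀ x, |h x| ≤ C := fun x => by rw [abs_of_nonneg (h0 x)]; exact hC x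
  have hle : ∀ x, a ≤ x → h x ≤ L := fun x hx =>
    ge_of_tendsto hL ((eventually_ge_atTop x).mono fun y hxy =>
      hmono (mem_Ici.2 hx) (mem_Ici.2 (hx.trans hxy)) hxy)
  have hgap : ∀ g : ℝ → ℝ, IntegrableOn g (Ioi a) →
      ∫ x in Ioi a, (L - h x) * g x = L * (∫ x in Ioi a, g x) - objective a h g := by
    intro g hg
    simp only [sub_mul]
    rw [integral_sub (hg.const_mul L) (integrableOn_mul_of_bounded hmeas hCabs hg),
      integral_const_mul, objective]
  have hgapi : ∀ g : ℝ → ℝ, IntegrableOn g (Ioi a) →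
      IntegrableOn (fun x => (L - h x) * g x) (Ioi a) := by
    intro g hg
    simp only [sub_mul]
    exact (hg.const_mul L).sub (integrableOn_mul_of_bounded hmeas hCabs hg)
  -- If `h` reaches `L` at `x`, the deficit `L - h` is zero from `x` on. A tail with its kink at `x`
  -- follows the lower bound for feasible tails wherever the deficit can count.
  by_cases hex : ∃ x ∈ Ioo a (a + mean η ν), h x = L
  · left
    obtain ⟨x, hx, hxL⟩ := hex
    have hx1 : x - a < mean η ν := by linarith [hx.2]
    have hx0 : 0 ≤ x - a := by linarith [hx.1]
    refine ⟨x - a, ⟨hx0, hx1⟩, ?_⟩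
    have hT := feasible_twoPiece (a := a) (β := β) hη hν hσ hx0 hx1
    have h1 := hgap _ hT.integrable
    have h2 := hgap _ hf.integrable
    rw [hT.mass] at h1
    rw [hf.mass] at h2
    have h3 : ∫ y in Ioi a, (L - h y) * twoPiece a η ν β (x - a) y
        ≤ ∫ y in Ioi a, (L - h y) * f y := by
      refine setIntegral_mono_on (hgapi _ hT.integrable) (hgapi _ hf.integrable)
        measurableSet_Ioi fun y hy => ?_
      have hy' : a < y := hy
      rcases le_total y x with hyx | hxy
      · exact mul_le_mul_of_nonneg_left (hf.twoPiece_le hy'.le (by linarith))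
          (sub_nonneg.2 (hle y hy'.le))
      · have : h y = L := le_antisymm (hle y hy'.le)
          (hxL ▸ hmono (mem_Ici.2 hx.1.le) (mem_Ici.2 hy'.le) hxy)
        rw [this, sub_self, zero_mul, zero_mul]
    linarith
  · right
    push Not at hex
    have hcutobj := objective_cutLine (a := a) hmeas hCabs hη hν
    have hcutmass := integral_Ioi_cutLine (a := a) (η := η) hν a
    rw [sub_self, sub_zero, max_eq_left hμ.le] at hcutmass
    have hcuti := integrableOn_cutLine (a := a) (η := η) hν a
    have hdi : IntegrableOn (fun x => f x - cutLine a η ν x) (Ioi a) := hf.integrable.sub hcuti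
    have hd := hgap _ hdi
    have hobj : objective a h (fun x => f x - cutLine a η ν x)
        = objective a h f - objective a h (cutLine a η ν) := by
      unfold objective
      rw [← integral_sub (integrableOn_mul_of_bounded hmeas hCabs hf.integrable)
        (integrableOn_mul_of_bounded hmeas hCabs hcuti)]
      simp only [mul_sub]
    rw [hobj, integral_sub hf.integrable hcuti, hf.mass, hcutmass] at hd
    have hnn : ∀ x ∈ Ioi a, 0 ≤ (L - h x) * (f x - cutLine a η ν x) := fun x hx =>
      mul_nonneg (sub_nonneg.2 (hle x (le_of_lt hx)))
        (sub_nonneg.2 (hf.cutLine_le hν (le_of_lt hx)))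
    -- This integral equals `W(μ)` minus the objective of `f`. Were it zero, `f` would agree a.e.
    -- with the cut line on `(a, a + μ)`, where `h` never equals `L`. But `f` must carry mass beyond
    -- `a + μ`, so it is positive there while the cut line vanishes.
    have hpos : 0 < ∫ x in Ioi a, (L - h x) * (f x - cutLine a η ν x) := by
      refine lt_of_le_of_ne (setIntegral_nonneg measurableSet_Ioi hnn) fun hzero => ?_
      have hae := (setIntegral_eq_zero_iff_of_nonneg_ae
        ((ae_restrict_iff' measurableSet_Ioi).2 (ae_of_all _ hnn)) (hgapi _ hdi)).1 hzero.symm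
      have hae' : ∀ᵐ x ∂volume, x ∈ Ioo a (a + mean η ν) → cutLine a η ν x = f x := by
        filter_upwards [(ae_restrict_iff' measurableSet_Ioi).1 hae] with x hx hxI
        rcases mul_eq_zero.1 (hx hxI.1) with h1 | h1
        · exact absurd (sub_eq_zero.1 h1).symm (hex x hxI)
        · exact (sub_eq_zero.1 h1).symm
      have heq := setIntegral_congr_ae (μ := volume) measurableSet_Ioo hae'
      rw [← integral_Ioc_eq_integral_Ioo, ← integral_Ioc_eq_integral_Ioo] at heq
      have hcut0 : cutLine a η ν (a + mean η ν) = 0 := by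
        rw [cutLine_eq_hinge hν, hinge_of_ge le_rfl, mul_zero]
      have hac : a ≤ a + mean η ν := by linarith
      have hfpos : 0 < f (a + mean η ν) := by
        refine lt_of_le_of_ne (hf.nonneg _ hac) fun hz => ?_
        have h1 := hf.tailMoment_zero_le hη hν hσ hac
        rw [setIntegral_congr_fun (g := fun _ => (0 : ℝ)) measurableSet_Ioi
          fun x hx => hf.eq_zero_of_le hac (le_of_lt hx) hz.symm] at h1
        simp only [integral_zero, add_sub_cancel_left] at h1
        have hden := denom_pos hσ (0 : ℝ)
        have h3 : 0 < max (second ν β - mean η ν * 0 - mean η ν * (mean η ν - 0)) 0 :=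
          lt_max_of_lt_left (by nlinarith)
        have h4 := nearWeight_pos (x₁ := 0) hσ
        have h2 : 0 < tailMoment η ν β (mean η ν) 0 := by
          unfold tailMoment
          positivity
        have := mul_pos (half_pos hν) h2
        linarith
      have := setIntegral_lt_of_lt (continuous_cutLine hν).continuousOn
        (hf.continuousOn_Ici.mono Icc_subset_Ici_self) (by linarith)
        (fun x hx => hf.cutLine_le hν hx.1.le) (right_mem_Icc.2 hac) (hcut0 ▸ hfpos)
      linarith
    rw [W, if_pos rfl]
    have := mul_second (β := β) hν
    have h5 : ν * (H a h (mean η ν) + L / 2 * (second ν β - mean η ν ^ 2))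
        = ν * H a h (mean η ν) + L * (β - ν / 2 * mean η ν ^ 2) := by
      linear_combination L / 2 * this
    linarith

/-- Every feasible objective value is attained by a two-piece tail or lies strictly below the
limiting value at `μ`. -/
lemma Feasible.objective_le_W_or_lt (hη : 0 < η) (hν : 0 < ν) (hσ : mean η ν ^ 2 < second ν β)
    (hmeas : Measurable h) (hreg : IsRegular a h) {lam : ℝ}
    (hlam : Tendsto (fun x => H a h x / x ^ 2) atTop (𝓝 lam)) (hf : Feasible a η ν β f) :
    (∃ x₁ ∈ Ico 0 (mean η ν), objective a h f ≤ W a η ν β h lam x₁) ∨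
      objective a h f < W a η ν β h lam (mean η ν) := by
  obtain ⟨C, hC⟩ := hreg.bounded
  have h0 := hreg.nonneg
  have hCabs : ∀ x, |h x| ≤ C := fun x => by rw [abs_of_nonneg (h0 x)]; exact hC x
  obtain ⟨c, hac, hmono, hanti⟩ := hreg.unimodal
  induction c using EReal.rec with
  | bot => simp at hac
  | top =>
    obtain ⟨L, hL⟩ := hreg.exists_tendsto
    have hLlam : L / 2 = lam := tendsto_nhds_unique (tendsto_H_div_sq hmeas hCabs hL a) hlam
    have hmono' : MonotoneOn h (Ici a) := hmono.mono fun x hx => ⟨hx, EReal.coe_lt_top x⟩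
    rcases hf.objective_le_or_lt_of_monotoneOn hη hν hσ hmeas h0 hC hmono' hL with
      ⟨x₁, hx₁, hle⟩ | hlt
    · refine Or.inl ⟨x₁, hx₁, ?_⟩
      rwa [← objective_twoPiece hmeas hCabs hη hν hσ hx₁.1 hx₁.2]
    · exact Or.inr (hLlam ▸ hlt)
  | coe c =>
    have hac' : a ≤ c := EReal.coe_le_coe_iff.1 hac
    obtain ⟨x₁, hx0, hx, hc1, hc2, hfc, htail⟩ := hf.exists_twoPiece hη hν hσ hac'
    refine Or.inl ⟨x₁, ⟨hx0, hx⟩, ?_⟩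
    rw [← objective_twoPiece hmeas hCabs hη hν hσ hx0 hx]
    exact objective_le_twoPiece hη hν hσ hmeas h0 hC
      (hmono.mono fun x hx => ⟨hx.1, EReal.coe_lt_coe_iff.2 hx.2⟩)
      (hanti.mono fun x hx => EReal.coe_lt_coe_iff.2 hx) hf hx0 hx hc1 hc2 hfc htail

end

/-! ### Optimizing sequences, optimal values and the degenerate case -/

section

variable {a η ν β : ℝ} {f h : ℝ → ℝ}

lemma monotoneOn_farPoint (hσ : mean η ν ^ 2 < second ν β) :
    MonotoneOn (farPoint η ν β) (Iio (mean η ν)) := by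
  intro x hx y hy hxy
  unfold farPoint
  rw [div_le_div_iff₀ (sub_pos.2 hx) (sub_pos.2 hy)]
  nlinarith [mul_nonneg (sub_nonneg.2 hxy) (sub_pos.2 hσ).le]

/-- With `t = μ - x₁` the weight is `t² / (t² + σ - μ²)`, which increases with `t ≥ 0`. -/
lemma antitoneOn_farWeight (hσ : mean η ν ^ 2 < second ν β) :
    AntitoneOn (farWeight η ν β) (Iio (mean η ν)) := by
  intro x hx y hy hxy
  have hx' : x < mean η ν := hx
  have hy' : y < mean η ν := hy
  unfold farWeight
  rw [div_le_div_iff₀ (denom_pos hσ y) (denom_pos hσ x)]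
  have h1 : (mean η ν - y) ^ 2 ≤ (mean η ν - x) ^ 2 := by
    apply pow_le_pow_left₀ <;> linarith
  nlinarith [mul_nonneg (sub_nonneg.2 h1) (sub_pos.2 hσ).le]

/-- A sequence of kinks increasing to `μ`. -/
noncomputable def kinkSeq (η ν : ℝ) (k : ℕ) : ℝ := mean η ν - mean η ν * (1 / ((k : ℝ) + 1))

lemma kinkSeq_nonneg (hμ : 0 < mean η ν) (k : ℕ) : 0 ≤ kinkSeq η ν k := by
  have h1 : 1 / ((k : ℝ) + 1) ≤ 1 := by
    rw [div_le_one (by positivity)]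
    linarith [(Nat.cast_nonneg k : (0 : ℝ) ≤ k)]
  unfold kinkSeq
  nlinarith

lemma kinkSeq_lt (hμ : 0 < mean η ν) (k : ℕ) : kinkSeq η ν k < mean η ν :=
  sub_lt_self _ (by positivity)

lemma monotone_kinkSeq (hμ : 0 < mean η ν) : Monotone (kinkSeq η ν) := fun _ _ hij =>
  sub_le_sub_left (mul_le_mul_of_nonneg_left (Nat.one_div_le_one_div hij) hμ.le) _

lemma tendsto_kinkSeq (hμ : 0 < mean η ν) :
    Tendsto (kinkSeq η ν) atTop (𝓝[<] (mean η ν)) := by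
  refine tendsto_nhdsWithin_iff.2 ⟨?_, Eventually.of_forall (kinkSeq_lt hμ)⟩
  have h1 := (tendsto_one_div_add_atTop_nhds_zero_nat (𝕜 := ℝ)).const_mul (mean η ν)
  have h2 := h1.const_sub (mean η ν)
  rwa [mul_zero, sub_zero] at h2

/-- The far hinge alone blows up. Once the far point has passed `x`, the first-moment identity
replaces weight times far point by `μ` minus the near term, leaving an expression continuous at `μ`.
-/
lemma tendsto_twoPiece (hν : 0 < ν) (hσ : mean η ν ^ 2 < second ν β) (x : ℝ) :
    Tendsto (fun x₁ => twoPiece a η ν β x₁ x) (𝓝[<] (mean η ν)) (𝓝 (cutLine a η ν x)) := by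
  have hn := continuous_nearWeight hσ
  have hw := continuous_farWeight hσ
  have hcont : Continuous fun x₁ => ν * nearWeight η ν β x₁ * hinge (a + x₁) x
      + ν * (mean η ν - nearWeight η ν β x₁ * x₁ + farWeight η ν β x₁ * (a - x)) := by
    unfold hinge
    fun_prop
  have h1 := (hcont.tendsto (mean η ν)).mono_left (nhdsWithin_le_nhds (s := Iio (mean η ν)))
  rw [nearWeight_mean hσ, farWeight_mean] at h1
  have h2 : cutLine a η ν x = ν * 1 * hinge (a + mean η ν) x
      + ν * (mean η ν - 1 * mean η ν + 0 * (a - x)) := by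
    rw [cutLine_eq_hinge hν]
    ring
  rw [h2]
  refine h1.congr' ?_
  filter_upwards [self_mem_nhdsWithin,
    (tendsto_farPoint hσ).eventually (eventually_ge_atTop (x - a))] with x₁ hx₁ hfar
  rw [twoPiece_eq_hinge hν hσ hx₁, hinge_of_le (u := a + farPoint η ν β x₁) (by linarith)]
  linear_combination (-ν) * weights_first_moment hσ hx₁

lemma IsRegular.exists_abs_le (hreg : IsRegular a h) : ∃ C : ℝ, ∀ x, |h x| ≤ C := by
  obtain ⟨C, hC⟩ := hreg.bounded
  exact ⟨C, fun x => by rw [abs_of_nonneg (hreg.nonneg x)]; exact hC x⟩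

lemma tendsto_objective_twoPiece (hη : 0 < η) (hν : 0 < ν) (hσ : mean η ν ^ 2 < second ν β)
    (hmeas : Measurable h) (hreg : IsRegular a h) {lam : ℝ}
    (hlam : Tendsto (fun x => H a h x / x ^ 2) atTop (𝓝 lam)) :
    Tendsto (fun k => objective a h (twoPiece a η ν β (kinkSeq η ν k))) atTop
      (𝓝 (W a η ν β h lam (mean η ν))) := by
  obtain ⟨C, hC⟩ := hreg.exists_abs_le
  have hμ := mean_pos hη hν
  refine ((tendsto_W hmeas hC hσ hlam).comp (tendsto_kinkSeq hμ)).congr fun k => ?_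
  exact (objective_twoPiece hmeas hC hη hν hσ (kinkSeq_nonneg hμ k) (kinkSeq_lt hμ k) lam).symm

lemma Feasible.objective_le_of_upperBound (hη : 0 < η) (hν : 0 < ν)
    (hσ : mean η ν ^ 2 < second ν β) (hmeas : Measurable h) (hreg : IsRegular a h) {lam : ℝ}
    (hlam : Tendsto (fun x => H a h x / x ^ 2) atTop (𝓝 lam)) (hf : Feasible a η ν β f) {Z : ℝ}
    (hZ : ∀ x ∈ Icc 0 (mean η ν), W a η ν β h lam x ≤ Z) : objective a h f ≤ Z := by
  rcases hf.objective_le_W_or_lt hη hν hσ hmeas hreg hlam with ⟨x₁, hx₁, hle⟩ | hlt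
  · exact hle.trans (hZ x₁ (Ico_subset_Icc_self hx₁))
  · exact hlt.le.trans (hZ _ (right_mem_Icc.2 (mean_pos hη hν).le))

lemma isLUB_feasibleValues (hη : 0 < η) (hν : 0 < ν) (hσ : mean η ν ^ 2 < second ν β)
    (hmeas : Measurable h) (hreg : IsRegular a h) {lam : ℝ}
    (hlam : Tendsto (fun x => H a h x / x ^ 2) atTop (𝓝 lam)) {Z : ℝ}
    (hZ : IsGreatest (W a η ν β h lam '' Icc 0 (mean η ν)) Z) :
    IsLUB (feasibleValues a η ν β h) Z := by
  obtain ⟨C, hC⟩ := hreg.exists_abs_le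
  have hμ := mean_pos hη hν
  refine ⟨?_, fun b hb => ?_⟩
  · rintro _ ⟨f, hf, rfl⟩
    exact hf.objective_le_of_upperBound hη hν hσ hmeas hreg hlam
      fun x hx => hZ.2 (mem_image_of_mem _ hx)
  · obtain ⟨⟨x₁, hx₁, rfl⟩, -⟩ := hZ
    rcases hx₁.2.eq_or_lt with rfl | hlt
    · exact le_of_tendsto' (tendsto_objective_twoPiece hη hν hσ hmeas hreg hlam) fun k =>
        hb ⟨_, feasible_twoPiece hη hν hσ (kinkSeq_nonneg hμ k) (kinkSeq_lt hμ k), rfl⟩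
    · rw [← objective_twoPiece hmeas hC hη hν hσ hx₁.1 hlt]
      exact hb ⟨_, feasible_twoPiece hη hν hσ hx₁.1 hlt, rfl⟩

lemma exists_isGreatest_W (hη : 0 < η) (hν : 0 < ν) (hσ : mean η ν ^ 2 < second ν β)
    (hmeas : Measurable h) (hreg : IsRegular a h) {lam : ℝ}
    (hlam : Tendsto (fun x => H a h x / x ^ 2) atTop (𝓝 lam)) :
    ∃ Z, IsGreatest (W a η ν β h lam '' Icc 0 (mean η ν)) Z := by
  obtain ⟨C, hC⟩ := hreg.exists_abs_le
  have h1 : ContinuousOn (W a η ν β h lam) (Icc 0 (mean η ν)) :=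
    (continuousOn_W hmeas hC hσ hlam).mono fun x hx => mem_Iic.2 hx.2
  exact (isCompact_Icc.image_of_continuousOn h1).exists_isGreatest
    ((nonempty_Icc.2 (mean_pos hη hν).le).image _)

lemma isOptimal_twoPiece (hη : 0 < η) (hν : 0 < ν) (hσ : mean η ν ^ 2 < second ν β)
    (hmeas : Measurable h) (hreg : IsRegular a h) {lam : ℝ}
    (hlam : Tendsto (fun x => H a h x / x ^ 2) atTop (𝓝 lam)) {x₁ : ℝ}
    (hx₁ : x₁ ∈ Ico 0 (mean η ν)) (hmax : IsMaxOn (W a η ν β h lam) (Icc 0 (mean η ν)) x₁) :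
    IsOptimal a η ν β h (twoPiece a η ν β x₁) := by
  obtain ⟨C, hC⟩ := hreg.exists_abs_le
  refine ⟨feasible_twoPiece hη hν hσ hx₁.1 hx₁.2, fun g hg => ?_⟩
  rw [objective_twoPiece hmeas hC hη hν hσ hx₁.1 hx₁.2 lam]
  exact hg.objective_le_of_upperBound hη hν hσ hmeas hreg hlam fun x hx => hmax hx

lemma W_mean_eq_of_forall_not_isMaxOn {lam Z : ℝ}
    (hZ : IsGreatest (W a η ν β h lam '' Icc 0 (mean η ν)) Z)
    (hno : ¬ ∃ x₁ ∈ Ico 0 (mean η ν), IsMaxOn (W a η ν β h lam) (Icc 0 (mean η ν)) x₁) :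
    W a η ν β h lam (mean η ν) = Z := by
  obtain ⟨⟨x₁, hx₁, rfl⟩, hub⟩ := hZ
  rcases hx₁.2.eq_or_lt with heq | hlt
  · rw [heq]
  · exact absurd ⟨x₁, ⟨hx₁.1, hlt⟩, fun x hx => hub (mem_image_of_mem _ hx)⟩ hno

lemma objective_cutLine_le (hmeas : Measurable h) (hreg : IsRegular a h) (hν : 0 < ν)
    (hf : Feasible a η ν β f) : objective a h (cutLine a η ν) ≤ objective a h f := by
  obtain ⟨C, hC⟩ := hreg.exists_abs_le
  exact setIntegral_mono_on (integrableOn_mul_of_bounded hmeas hC (integrableOn_cutLine hν a))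
    (integrableOn_mul_of_bounded hmeas hC hf.integrable) measurableSet_Ioi fun x hx =>
      mul_le_mul_of_nonneg_left (hf.cutLine_le hν (le_of_lt hx)) (hreg.nonneg x)

/-- If `λ ≤ 0`, then `W(μ)` is at most the objective of the cut line, which lies below every
feasible tail. So `W(μ) ≤ W(0)`, and `0` would be a maximizer. -/
lemma lam_pos_of_forall_not_isMaxOn (hη : 0 < η) (hν : 0 < ν) (hσ : mean η ν ^ 2 < second ν β)
    (hmeas : Measurable h) (hreg : IsRegular a h) {lam Z : ℝ}
    (hZ : IsGreatest (W a η ν β h lam '' Icc 0 (mean η ν)) Z)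
    (hno : ¬ ∃ x₁ ∈ Ico 0 (mean η ν), IsMaxOn (W a η ν β h lam) (Icc 0 (mean η ν)) x₁) :
    0 < lam := by
  obtain ⟨C, hC⟩ := hreg.exists_abs_le
  have hμ := mean_pos hη hν
  by_contra! hle
  have hWZ := W_mean_eq_of_forall_not_isMaxOn hZ hno
  have h1 : Z ≤ W a η ν β h lam 0 := by
    rw [← hWZ, ← objective_twoPiece hmeas hC hη hν hσ le_rfl hμ lam]
    refine le_trans ?_
      (objective_cutLine_le hmeas hreg hν (feasible_twoPiece hη hν hσ le_rfl hμ))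
    rw [objective_cutLine hmeas hC hη hν, W, if_pos rfl]
    have := mul_nonpos_of_nonpos_of_nonneg hle (sub_pos.2 hσ).le
    nlinarith
  exact hno ⟨0, ⟨le_rfl, hμ⟩, fun x hx => (hZ.2 (mem_image_of_mem _ hx)).trans h1⟩

lemma Feasible.mean_sq_le_second (hη : 0 < η) (hν : 0 < ν) (hf : Feasible a η ν β f) :
    mean η ν ^ 2 ≤ second ν β := by
  have h1 : ∫ x in Ioi a, cutLine a η ν x ≤ ∫ x in Ioi a, f x :=
    setIntegral_mono_on (integrableOn_cutLine hν a) hf.integrable measurableSet_Ioi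
      fun x hx => hf.cutLine_le hν (le_of_lt hx)
  rw [integral_Ioi_cutLine hν, hf.mass, sub_self, sub_zero,
    max_eq_left (mean_pos hη hν).le] at h1
  have h2 := mul_second (β := β) hν
  nlinarith

/-- The cut line is a lower bound that already has the full mass `β`, so every feasible tail equals
it a.e. and all objectives coincide. -/
lemma isOptimal_cutLine (hη : 0 < η) (hν : 0 < ν) (hσ : mean η ν ^ 2 = second ν β) :
    IsOptimal a η ν β h (cutLine a η ν) := by
  have hcut := feasible_cutLine (a := a) (β := β) hη hν hσ
  refine ⟨hcut, fun g hg => le_of_eq ?_⟩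
  have h0 : ∫ x in Ioi a, (g x - cutLine a η ν x) = 0 := by
    rw [integral_sub hg.integrable hcut.integrable, hg.mass, hcut.mass, sub_self]
  have hae := (setIntegral_eq_zero_iff_of_nonneg_ae ((ae_restrict_iff' measurableSet_Ioi).2
    (ae_of_all _ fun x hx => sub_nonneg.2 (hg.cutLine_le hν (le_of_lt hx))))
    (hg.integrable.sub hcut.integrable)).1 h0
  refine integral_congr_ae ?_
  filter_upwards [hae] with x hx
  rw [sub_eq_zero.1 hx]

end

end ConvexTail

/-! ### Assembly of the three parts -/

theorem theorem4 (a η ν β : ℝ) (hη : 0 < η) (hν : 0 < ν) (hβ : 0 < β)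
    (h : ℝ → ℝ) (hmeas : Measurable h) (hreg : IsRegular a h) :
    -- First part: at most two linear pieces suffice.
    ((∃ f, Feasible a η ν β f) →
      (∃ f ∈ PLPlus a 2, IsOptimal a η ν β h f) ∨
      ((¬ ∃ f, IsOptimal a η ν β h f) ∧
        ∃ (Z : ℝ) (F : ℕ → ℝ → ℝ) (y : ℕ → Fin 3 → ℝ) (c d : ℕ → Fin 2 → ℝ),
          IsLUB (feasibleValues a η ν β h) Z ∧
          (∀ k, Feasible a η ν β (F k)) ∧
          (∀ k, IsPLRep a 2 (F k) (y k) (c k) (d k)) ∧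
          Tendsto (fun k => objective a h (F k)) atTop (𝓝 Z) ∧
          -- the last line segment is a genuine one
          (∀ k, y k 1 < y k 2 ∧ d k 1 < 0) ∧
          Monotone (fun k => y k 2) ∧ Tendsto (fun k => y k 2) atTop atTop ∧
          Monotone (fun k => d k 1) ∧ Tendsto (fun k => d k 1) atTop (𝓝 0))) ∧
    (η ^ 2 < 2 * β * ν → ∀ lam : ℝ, Tendsto (fun x => H a h x / x ^ 2) atTop (𝓝 lam) →
      ∃ Z : ℝ,
        -- Second part: the optimal value is the maximum of `W` over `[0, μ]`.
        IsLUB (feasibleValues a η ν β h) Z ∧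
        IsGreatest (W a η ν β h lam '' Icc 0 (mean η ν)) Z ∧
        -- Third part: a maximizer in `[0, μ)` gives an optimal solution.
        (∀ x₁ ∈ Ico 0 (mean η ν), IsMaxOn (W a η ν β h lam) (Icc 0 (mean η ν)) x₁ →
          IsOptimal a η ν β h (twoPiece a η ν β x₁)) ∧
        -- Otherwise there is an optimizing sequence with the cut line as limit, and `λ > 0`.
        ((¬ ∃ x₁ ∈ Ico 0 (mean η ν), IsMaxOn (W a η ν β h lam) (Icc 0 (mean η ν)) x₁) →
          (∃ F : ℕ → ℝ → ℝ,
            (∀ k, Feasible a η ν β (F k)) ∧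
            Tendsto (fun k => objective a h (F k)) atTop (𝓝 Z) ∧
            ∀ x, a ≤ x → Tendsto (fun k => F k x) atTop (𝓝 (cutLine a η ν x))) ∧
          0 < lam)) := by
  have hμ := mean_pos hη hν
  obtain ⟨C, hC⟩ := hreg.exists_abs_le
  constructor
  · rintro ⟨f₀, hf₀⟩
    rcases (hf₀.mean_sq_le_second hη hν).eq_or_lt with hσ | hσ
    · exact Or.inl ⟨_, cutLine_mem_PLPlus hη hν, isOptimal_cutLine hη hν hσ⟩
    -- The first part does not assume `λ`; unimodality and boundedness of `h` supply it as `L / 2`.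
    obtain ⟨L, hL⟩ := hreg.exists_tendsto
    have hlam := tendsto_H_div_sq hmeas hC hL a
    obtain ⟨Z, hZ⟩ := exists_isGreatest_W hη hν hσ hmeas hreg hlam
    by_cases hno : ∃ x₁ ∈ Ico 0 (mean η ν), IsMaxOn (W a η ν β h (L / 2)) (Icc 0 (mean η ν)) x₁
    · obtain ⟨x₁, hx₁, hmax⟩ := hno
      exact Or.inl ⟨_, ⟨_, _, _, isPLRep_twoPiece hη hν hσ hx₁.1 hx₁.2⟩,
        isOptimal_twoPiece hη hν hσ hmeas hreg hlam hx₁ hmax⟩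
    have hWZ := W_mean_eq_of_forall_not_isMaxOn hZ hno
    have hLUB := isLUB_feasibleValues hη hν hσ hmeas hreg hlam hZ
    have hk0 := kinkSeq_nonneg hμ
    have hk1 := kinkSeq_lt hμ
    refine Or.inr ⟨?_, Z, fun k => twoPiece a η ν β (kinkSeq η ν k), _, _, _, hLUB,
      fun k => feasible_twoPiece hη hν hσ (hk0 k) (hk1 k),
      fun k => isPLRep_twoPiece hη hν hσ (hk0 k) (hk1 k),
      hWZ ▸ tendsto_objective_twoPiece hη hν hσ hmeas hreg hlam, fun k => ⟨?_, ?_⟩, ?_, ?_, ?_, ?_⟩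
    -- An optimum would have value `Z = W(μ)`. Either some `W(x₁)` with `x₁ < μ` reaches it, making
    -- `x₁` a maximizer, or the value is strictly below `W(μ)`.
    · rintro ⟨f, hf, hopt⟩
      have hZf : Z ≤ objective a h f := hLUB.2 (by rintro _ ⟨g, hg, rfl⟩; exact hopt g hg)
      rcases hf.objective_le_W_or_lt hη hν hσ hmeas hreg hlam with ⟨x₁, hx₁, hle⟩ | hlt
      · exact hno ⟨x₁, hx₁, fun x hx => (hZ.2 (mem_image_of_mem _ hx)).trans (hZf.trans hle)⟩
      · linarith
    · have := mean_lt_farPoint hσ (hk1 k)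
      simpa using (hk1 k).trans this
    · simpa using mul_pos hν (farWeight_pos hσ (hk1 k))
    · intro i j hij
      simpa using monotoneOn_farPoint hσ (hk1 i) (hk1 j) (monotone_kinkSeq hμ hij)
    · exact tendsto_atTop_add_const_right _ _ ((tendsto_farPoint hσ).comp (tendsto_kinkSeq hμ))
    · intro i j hij
      exact neg_le_neg (mul_le_mul_of_nonneg_left
        (antitoneOn_farWeight hσ (hk1 i) (hk1 j) (monotone_kinkSeq hμ hij)) hν.le)
    · have h1 := ((continuous_farWeight hσ).tendsto (mean η ν)).comp
        ((tendsto_kinkSeq hμ).mono_right nhdsWithin_le_nhds)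
      rw [farWeight_mean] at h1
      simpa using (h1.const_mul ν).neg
  · intro hlt lam hlam
    have hσ := mean_sq_lt_second hν hlt
    obtain ⟨Z, hZ⟩ := exists_isGreatest_W hη hν hσ hmeas hreg hlam
    refine ⟨Z, isLUB_feasibleValues hη hν hσ hmeas hreg hlam hZ, hZ,
      fun x₁ hx₁ hmax => isOptimal_twoPiece hη hν hσ hmeas hreg hlam hx₁ hmax,
      fun hno => ⟨⟨fun k => twoPiece a η ν β (kinkSeq η ν k),
        fun k => feasible_twoPiece hη hν hσ (kinkSeq_nonneg hμ k) (kinkSeq_lt hμ k), ?_,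
        fun x _ => (tendsto_twoPiece hν hσ x).comp (tendsto_kinkSeq hμ)⟩,
        lam_pos_of_forall_not_isMaxOn hη hν hσ hmeas hreg hZ hno⟩⟩
    rw [← W_mean_eq_of_forall_not_isMaxOn hZ hno]
    exact tendsto_objective_twoPiece hη hν hσ hmeas hreg hlam
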